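/- Let $p$ be a prime, $m\ge 1$ and $s\ge 1$ integers, $N=p^m$, and let $f\in\mathbb F_p[x]$ be irreducible with $\deg f=m$. Let $(\gamma_j)_{j\ge1}$ be a non-increasing sequence of real numbers with $0<\gamma_j\le 1$, put $\gamma_{\mathfrak u}=\prod_{j\in\mathfrak u}\gamma_j$ for $\mathfrak u\subseteq[s]=\{1,\dots,s\}$, and let $(w_j)_{j\ge1}$ be a non-decreasing sequence of nonnegative integers. *Point set and discrepancy.* Identify $\mathbb F_p$ with $\{0,\dots,p-1\}$ and, for a Laurent series over $\mathbb F_p$ in $x^{-1}$, set $\phi_m\bigl(\sum_{l\ge\omega}t_lx^{-l}\bigr)=\sum_{l=\max\{1,\omega\}}^m t_lp^{-l}$. For $0\le n<p^m$ with base-$p$ expansion $n=\sum_{r<m}n_rp^r$ let $n(x)=\sum_{r<m}n_rx^r$. For $\boldsymbol q=(q_1,\dots,q_s)\in\mathbb F_p[x]^s$ the polynomial lattice point set $\mathcal P(\boldsymbol q,f)$ consists of the $N$ points (counted with multiplicity) $\boldsymbol x_n=\bigl(\phi_m(n(x)q_1/f),\dots,\phi_m(n(x)q_s/f)\bigr)$,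 $0\le n<N$. Its weighted star discrepancy is $$D^*_{N,\boldsymbol\gamma}(\boldsymbol q,f)=\sup_{\boldsymbol t\in(0,1]^s}\ \max_{\emptyset\ne\mathfrak u\subseteq[s]}\gamma_{\mathfrak u}\,\bigl|\Delta((\boldsymbol t_{\mathfrak u},\boldsymbol 1))\bigr|,\qquad \Delta(\boldsymbol t)=\frac1N\#\Bigl\{n:\boldsymbol x_n\in\prod_{j=1}^s[0,t_j)\Bigr\}-\prod_{j=1}^st_j,$$ where $(\boldsymbol t_{\mathfrak u},\boldsymbol 1)$ has $j$th coordinate $t_j$ if $j\in\mathfrak u$ and $1$ otherwise. *Construction.* Let $G_{p,m}$ be the set of polynomials over $\mathbb F_p$ of degree $<m$. For nonzero $h=h_0+\dots+h_ax^a$ with $h_a\ne0$ let $r_p(h)=p^{-a-1}\sin^{-2}(\pi h_a/p)$, and let $r_p(0,\gamma)=1+\gamma$ and $r_p(h,\gamma)=\gamma\, r_p(h)$ for $h\neq 0$. For $\boldsymbol q\in\mathbb F_p[x]^d$ let $$R^d_{\boldsymbol\gamma}(\boldsymbol q,f)=\sum_{\substack{\boldsymbol h\in G_{p,m}^d\setminus\{\boldsymbol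 0\}\\ h_1q_1+\dots+h_dq_d\equiv0\ (\mathrm{mod}\ f)}}\ \prod_{i=1}^dr_p(h_i,\gamma_i).$$ For $w<m$ let $\mathcal G_{p,m-w}(f)$ be the set of polynomials of degree $<m-w$ that are coprime to $f$, and for $w\ge m$ let $\mathcal G_{p,m-w}(f)=\{1\}$. Let $(g_1,\dots,g_s)$ with $g_i\in\mathcal G_{p,m-w_i}(f)$ be any vector constructed by the reduced component-by-component algorithm, that is, $g_1=1$ and, for $d=1,\dots,s-1$, $g_{d+1}$ minimizes $q\mapsto R^{d+1}_{\boldsymbol\gamma}\bigl((x^{w_1}g_1,\dots,x^{w_d}g_d,x^{w_{d+1}}q),f\bigr)$ over $q\in\mathcal G_{p,m-w_{d+1}}(f)$. Then $$D^*_{N,\boldsymbol\gamma}\bigl((x^{w_1}g_1,\dots,x^{w_s}g_s),f\bigr)\le\sum_{\emptyset\ne\mathfrak u\subseteq[s]}\gamma_{\mathfrak u}\Bigl(1-\Bigl(1-\frac1N\Bigr)^{|\mathfrak u|}\Bigr)+\frac1N\prod_{i=1}^s\Bigl(1+\gamma_i+\gamma_i\,p^{\min\{w_i,m\}}\,m\,\frac{p+1}{3}\Bigr).$$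 -/

import Mathlib

open Polynomial

noncomputable section

namespace PolyLattice

/-! Coordinates are indexed by `Fin s = {0, …, s - 1}`; index `i` here is the coordinate usually
called `i + 1`. -/

/-! ### Weighted star discrepancy -/

/-- Product weights `γ_u = ∏_{j ∈ u} γ_j` (so `γ_∅ = 1`). -/
def prodWeight {s : ℕ} (γ : Fin s → ℝ) (u : Finset (Fin s)) : ℝ := ∏ j ∈ u, γ j

/-- The box `[0, t) = [0, t_1) × ⋯ × [0, t_s)`. -/
def box {s : ℕ} (t : Fin s → ℝ) : Set (Fin s → ℝ) :=
  Set.univ.pi fun j => Set.Ico 0 (t j)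

/-- Local discrepancy at `t` of the points `x_0, …, x_{N-1}` (counted with multiplicity). -/
def localDisc {N s : ℕ} (x : Fin N → Fin s → ℝ) (t : Fin s → ℝ) : ℝ :=
  (1 / (N : ℝ)) * ∑ n, (box t).indicator (fun _ => (1 : ℝ)) (x n) - ∏ j, t j

/-- The vector `(t_u, 1)`. -/
def fillOne {s : ℕ} (u : Finset (Fin s)) (t : Fin s → ℝ) : Fin s → ℝ :=
  fun j => if j ∈ u then t j else 1

/-- Weighted star discrepancy: the supremum over `t ∈ (0, 1]^s` of the maximum over nonempty
`u ⊆ [s]` of `γ_u |Δ((t_u, 1), P)|`. The supremum is over a bounded set, because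
`|Δ| ≤ 1` on `(0, 1]^s`. -/
def weightedStarDisc {N s : ℕ} (γ : Finset (Fin s) → ℝ) (x : Fin N → Fin s → ℝ) : ℝ :=
  ⨆ t : Set.univ.pi (fun _ : Fin s => Set.Ioc (0 : ℝ) 1),
    ⨆ u : {u : Finset (Fin s) // u.Nonempty}, γ u.1 * |localDisc x (fillOne u.1 t.1)|

/-! ### Polynomial lattice point sets -/

/-- The embedding of `𝔽_p[x]` in `𝔽_p((x⁻¹))`. An element of `LaurentSeries (ZMod p)` is read as a
Laurent series in the variable `x⁻¹`, that is, its coefficient at `l` is the coefficient of `x^{-l}`;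
hence `x` is `single (-1) 1`. -/
def toLaurent (p : ℕ) [Fact p.Prime] : (ZMod p)[X] →ₐ[ZMod p] LaurentSeries (ZMod p) :=
  aeval (HahnSeries.single (-1 : ℤ) (1 : ZMod p))

/-- `φ_m (∑_l t_l x^{-l}) = ∑_{l=1}^m t_l p^{-l}`, with `t_l` read in `{0, …, p - 1}`. -/
def phi (p : ℕ) [Fact p.Prime] (m : ℕ) (L : LaurentSeries (ZMod p)) : ℝ :=
  ∑ l ∈ Finset.Icc 1 m, ((L.coeff (l : ℤ)).val : ℝ) / (p : ℝ) ^ l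

/-- The polynomial `n(x) = ∑_{r<m} n_r x^r`, where `n_r` are the base `p` digits of `n`. -/
def natPoly (p m n : ℕ) : (ZMod p)[X] :=
  ∑ r ∈ Finset.range m, C ((n / p ^ r % p : ℕ) : ZMod p) * X ^ r

/-- The `N = p^m` points of the polynomial lattice point set `P(g, f)`. -/
def latticePoint (p : ℕ) [Fact p.Prime] (m : ℕ) {s : ℕ} (g : Fin s → (ZMod p)[X])
    (f : (ZMod p)[X]) (n : Fin (p ^ m)) : Fin s → ℝ :=
  fun i => phi p m (toLaurent p (natPoly p m n * g i) / toLaurent p f)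

/-! ### The quantity `R` and the reduced component-by-component construction -/

/-- `G_{p,m}`, the polynomials of degree `< m`, is finite. -/
instance fintypeDegreeLT (p : ℕ) [Fact p.Prime] (m : ℕ) : Fintype (degreeLT (ZMod p) m) :=
  Fintype.ofEquiv (Fin m → ZMod p) (degreeLTEquiv (ZMod p) m).symm.toEquiv

/-- `r_p(h) = 1 / (p^{a+1} sin²(π h_a / p))` for `h ≠ 0` of degree `a` with leading coefficient
`h_a`. -/
def rho (p : ℕ) (h : (ZMod p)[X]) : ℝ :=
  1 / ((p : ℝ) ^ (h.natDegree + 1) *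
    Real.sin (Real.pi / p * (h.leadingCoeff.val : ℝ)) ^ 2)

open Classical in
/-- `r_p(h, γ)`: equal to `1 + γ` if `h = 0`, and to `γ r_p(h)` otherwise. -/
def rhoW (p : ℕ) (h : (ZMod p)[X]) (γ : ℝ) : ℝ :=
  if h = 0 then 1 + γ else γ * rho p h

open Classical in
/-- `R^d_γ(g, f)`: the sum of `∏ r_p(h_i, γ_i)` over nonzero `h ∈ G_{p,m}^d` with
`h · g ≡ 0 (mod f)`. -/
def R (p : ℕ) [Fact p.Prime] (m : ℕ) {d : ℕ} (γ : Fin d → ℝ) (g : Fin d → (ZMod p)[X])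
    (f : (ZMod p)[X]) : ℝ :=
  ∑ h : Fin d → degreeLT (ZMod p) m with
      h ≠ 0 ∧ f ∣ ∑ i, (h i : (ZMod p)[X]) * g i,
    ∏ i, rhoW p (h i : (ZMod p)[X]) (γ i)

/-- The reduced search set: polynomials of degree `< m - w` coprime to `f` if `w < m`, and `{1}` if
`w ≥ m`. -/
def searchSet (p m w : ℕ) (f : (ZMod p)[X]) : Set (ZMod p)[X] :=
  if w < m then {g | g.degree < ((m - w : ℕ) : WithBot ℕ) ∧ IsCoprime g f} else {1}

/-- The vector `(x^{w_1} g_1, …, x^{w_d} g_d, x^{w_{d+1}} q)` of length `d + 1`. -/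
def extendBy {p s : ℕ} (w : ℕ → ℕ) (g : Fin s → (ZMod p)[X]) (d : Fin s) (q : (ZMod p)[X]) :
    Fin (d.val + 1) → (ZMod p)[X] :=
  Fin.snoc (α := fun _ => (ZMod p)[X])
    (fun i : Fin d.val => X ^ w i.val * g (i.castLE d.isLt.le)) (X ^ w d.val * q)

/-- `g = (g_1, …, g_s)` is a possible output of the reduced component-by-component algorithm:
every component lies in its search set, the first component is `1`, and every later component
minimizes `R` over its search set, given the earlier components. -/
structure IsReducedCBC (p : ℕ) [Fact p.Prime] (m : ℕ) {s : ℕ} (γ : ℕ → ℝ) (w : ℕ → ℕ)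
    (f : (ZMod p)[X]) (g : Fin s → (ZMod p)[X]) : Prop where
  mem : ∀ i : Fin s, g i ∈ searchSet p m (w i.val) f
  first : ∀ i : Fin s, i.val = 0 → g i = 1
  step : ∀ d : Fin s, d.val ≠ 0 → ∀ q ∈ searchSet p m (w d.val) f,
    R p m (fun i : Fin (d.val + 1) => γ i.val) (extendBy w g d (g d)) f ≤
      R p m (fun i : Fin (d.val + 1) => γ i.val) (extendBy w g d q) f

end PolyLattice

end

/-!
Fourier analysis on the digits expands the indicator of a box whose corners are multiples of `1 / N`
into Walsh functions. Averaged over the points of the lattice, a Walsh function contributes only if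
its index vector `h` is dual, `h · q ≡ 0 (mod f)`; its coefficient is at most `∏ r_p(h_i)` since
it factors into geometric sums. Thus the discrepancy at such a grid corner is at most `R`, and
rounding an arbitrary corner up to the grid costs at most `1 - (1 - 1 / N) ^ |u|`.

For the construction, split `R` in dimension `d + 1` according to whether the last entry of `h` is
zero. Only the remainder depends on the new component `q`, and its minimum is at most its mean.
The polynomials `x ^ w q`, `deg q < m - w`, are pairwise incongruent modulo `f`, so the sum over
`q` meets every `h` at most once and is bounded by a full product of sums of `r_p`, which the
cosecant identity `∑ 1 / sin² (π c / p) = (p² - 1) / 3` evaluates.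
-/

noncomputable section

namespace PolyLattice

/-! ### Characters of `ZMod n` -/

section Characters

variable {n : ℕ} [NeZero n]

theorem stdAddChar_sum {ι : Type*} (s : Finset ι) (e : ι → ZMod n) :
    ZMod.stdAddChar (∑ i ∈ s, e i) = ∏ i ∈ s, ZMod.stdAddChar (e i) := by
  classical
  induction s using Finset.induction_on with
  | empty => simp
  | insert a s ha ih => rw [Finset.sum_insert ha, Finset.prod_insert ha, AddChar.map_add_eq_mul, ih]

theorem stdAddChar_pow_eq_one (c : ZMod n) : ZMod.stdAddChar c ^ n = 1 := by
  rw [← AddChar.map_nsmul_eq_pow]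
  simp

theorem stdAddChar_eq_one_iff {c : ZMod n} : ZMod.stdAddChar c = 1 ↔ c = 0 :=
  (ZMod.isPrimitive_stdAddChar n).zmod_char_eq_one_iff n c

theorem norm_stdAddChar_sub_one (c : ZMod n) :
    ‖ZMod.stdAddChar c - 1‖ = 2 * |Real.sin (Real.pi / n * c.val)| := by
  have hexp : ZMod.stdAddChar c =
      Complex.exp (Complex.I * ((2 * (Real.pi / n * c.val) : ℝ) : ℂ)) := by
    have h := ZMod.stdAddChar_coe (N := n) (c.val : ℤ)
    rw [Int.cast_natCast, ZMod.natCast_zmod_val] at h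
    rw [h]
    congr 1
    push_cast
    ring
  rw [hexp, Complex.norm_exp_I_mul_ofReal_sub_one, mul_div_cancel_left₀ _ two_ne_zero, norm_mul,
    Real.norm_eq_abs, Real.norm_eq_abs, abs_two]

theorem norm_stdAddChar_neg_sub_one (c : ZMod n) :
    ‖ZMod.stdAddChar (-c) - 1‖ = 2 * |Real.sin (Real.pi / n * c.val)| := by
  rw [AddChar.map_neg_eq_conj, ← map_one (starRingEnd ℂ), ← map_sub, RCLike.norm_conj,
    norm_stdAddChar_sub_one]

theorem sin_pi_div_mul_val_ne_zero {c : ZMod n} (hc : c ≠ 0) :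
    Real.sin (Real.pi / n * c.val) ≠ 0 := fun h ↦ hc <| by
  have := norm_stdAddChar_sub_one c
  rwa [h, abs_zero, mul_zero, norm_eq_zero, sub_eq_zero, stdAddChar_eq_one_iff] at this

theorem sum_stdAddChar_dotProduct {ι : Type*} [Fintype ι] [DecidableEq ι] (e : ι → ZMod n) :
    ∑ c : ι → ZMod n, ZMod.stdAddChar (∑ i, c i * e i) =
      if e = 0 then (n : ℂ) ^ Fintype.card ι else 0 := by
  simp_rw [stdAddChar_sum]
  rw [← Fintype.prod_sum fun i c ↦ ZMod.stdAddChar (c * e i)]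
  simp_rw [AddChar.sum_mulShift _ (ZMod.isPrimitive_stdAddChar n), ZMod.card]
  split_ifs with h
  · simp [h]
  · obtain ⟨i, hi⟩ := Function.ne_iff.mp h
    refine Finset.prod_eq_zero (Finset.mem_univ i) ?_
    rw [if_neg (by simpa using hi), Nat.cast_zero]

theorem sum_norm_sq_sum_mul_stdAddChar (F : ZMod n → ℂ) :
    ∑ c, ‖∑ j, F j * ZMod.stdAddChar (c * j)‖ ^ 2 = n * ∑ j, ‖F j‖ ^ 2 := by
  have hsq (c : ZMod n) : ((‖∑ j, F j * ZMod.stdAddChar (c * j)‖ ^ 2 : ℝ) : ℂ) =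
      ∑ j, ∑ k, F j * starRingEnd ℂ (F k) * ZMod.stdAddChar (c * (j - k)) := by
    push_cast
    rw [← Complex.mul_conj', map_sum, Finset.sum_mul_sum]
    refine Finset.sum_congr rfl fun j _ ↦ Finset.sum_congr rfl fun k _ ↦ ?_
    rw [map_mul (starRingEnd ℂ), ← AddChar.map_neg_eq_conj, mul_sub, sub_eq_add_neg,
      AddChar.map_add_eq_mul]
    ring
  apply Complex.ofReal_injective
  calc ((∑ c, ‖∑ j, F j * ZMod.stdAddChar (c * j)‖ ^ 2 : ℝ) : ℂ)
      = ∑ j, ∑ k, F j * starRingEnd ℂ (F k) * ∑ c, ZMod.stdAddChar (c * (j - k)) := by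
        rw [Complex.ofReal_sum]
        simp_rw [hsq, Finset.mul_sum]
        rw [Finset.sum_comm]
        exact Finset.sum_congr rfl fun j _ ↦ Finset.sum_comm
    _ = ((n * ∑ j, ‖F j‖ ^ 2 : ℝ) : ℂ) := by
        simp_rw [AddChar.sum_mulShift _ (ZMod.isPrimitive_stdAddChar n), sub_eq_zero, ZMod.card]
        simp [Complex.mul_conj', Finset.mul_sum, mul_comm]

end Characters

/-! ### The cosecant sum -/

section Cosecant

theorem geom_sum_eq_zero_of_pow_eq_one {F : Type*} [DivisionRing F] {ζ : F} {n : ℕ}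
    (hζ : ζ ^ n = 1) (hζ1 : ζ ≠ 1) : ∑ j ∈ Finset.range n, ζ ^ j = 0 := by
  rw [geom_sum_eq hζ1, hζ, sub_self, zero_div]

theorem sub_one_mul_sum_range_mul_pow {A : Type*} [CommRing A] (ζ : A) (n : ℕ) :
    (ζ - 1) * ∑ j ∈ Finset.range n, j * ζ ^ j =
      n * ζ ^ n - ζ * ∑ j ∈ Finset.range n, ζ ^ j := by
  induction n with
  | zero => simp
  | succ n ih =>
    rw [Finset.sum_range_succ, Finset.sum_range_succ, mul_add, ih]
    push_cast
    ring

theorem sum_range_sq {K : Type*} [Field K] [CharZero K] (n : ℕ) :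
    ∑ j ∈ Finset.range n, (j : K) ^ 2 = n * (n - 1) * (2 * n - 1) / 6 := by
  induction n with
  | zero => simp
  | succ n ih =>
    rw [Finset.sum_range_succ, ih]
    push_cast
    ring

variable {n : ℕ} [NeZero n]

theorem sum_val_eq_sum_range {A : Type*} [AddCommMonoid A] (G : ℕ → A) :
    ∑ c : ZMod n, G c.val = ∑ j ∈ Finset.range n, G j := by
  obtain ⟨n, rfl⟩ := Nat.exists_eq_succ_of_ne_zero (NeZero.ne n)
  exact Fin.sum_univ_eq_sum_range G _

theorem norm_sq_sum_val_mul_stdAddChar {c : ZMod n} (hc : c ≠ 0) :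
    ‖∑ j : ZMod n, (j.val : ℂ) * ZMod.stdAddChar (c * j)‖ ^ 2 =
      n ^ 2 / 4 * (1 / Real.sin (Real.pi / n * c.val) ^ 2) := by
  set ζ := ZMod.stdAddChar c
  have hζ : ζ ^ n = 1 := stdAddChar_pow_eq_one c
  have hpow (j : ZMod n) : ZMod.stdAddChar (c * j) = ζ ^ j.val := by
    rw [← AddChar.map_nsmul_eq_pow, nsmul_eq_mul, ZMod.natCast_zmod_val, mul_comm]
  have hprod : (ζ - 1) * ∑ j : ZMod n, (j.val : ℂ) * ZMod.stdAddChar (c * j) = n := by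
    simp_rw [hpow]
    rw [sum_val_eq_sum_range fun j ↦ (j : ℂ) * ζ ^ j, sub_one_mul_sum_range_mul_pow, hζ,
      geom_sum_eq_zero_of_pow_eq_one hζ (stdAddChar_eq_one_iff.not.mpr hc)]
    simp
  have hnorm := congrArg (‖·‖ ^ 2) hprod
  simp only [norm_mul, ζ, norm_stdAddChar_sub_one, Complex.norm_natCast, mul_pow, sq_abs] at hnorm
  have hsin := sin_pi_div_mul_val_ne_zero hc
  rw [div_mul_div_comm, mul_one, eq_div_iff (by positivity)]
  linear_combination hnorm

theorem norm_sq_sum_val :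
    ‖∑ j : ZMod n, (j.val : ℂ)‖ ^ 2 = (n * (n - 1) / 2 : ℝ) ^ 2 := by
  have hgauss : (∑ j ∈ Finset.range n, j : ℝ) * 2 = n * (n - 1) := by
    have := Finset.sum_range_id_mul_two n
    rw [← @Nat.cast_inj ℝ] at this
    push_cast [Nat.cast_sub (NeZero.one_le (n := n))] at this
    exact this
  rw [← Nat.cast_sum, Complex.norm_natCast, sum_val_eq_sum_range fun j ↦ j, Nat.cast_sum]
  congr 1
  linarith

theorem sum_one_div_sin_sq :
    ∑ c : ZMod n with c ≠ 0, 1 / Real.sin (Real.pi / n * c.val) ^ 2 = ((n : ℝ) ^ 2 - 1) / 3 := by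
  have parseval := sum_norm_sq_sum_mul_stdAddChar fun j : ZMod n ↦ (j.val : ℂ)
  rw [← Finset.sum_filter_add_sum_filter_not Finset.univ (· ≠ 0),
    Finset.sum_congr rfl fun c hc ↦ norm_sq_sum_val_mul_stdAddChar (Finset.mem_filter.mp hc).2,
    ← Finset.mul_sum] at parseval
  simp only [not_not, Finset.filter_eq', Finset.mem_univ, if_true, Finset.sum_singleton, zero_mul,
    AddChar.map_zero_eq_one, mul_one, norm_sq_sum_val, Complex.norm_natCast] at parseval
  rw [sum_val_eq_sum_range fun j ↦ (j : ℝ) ^ 2, sum_range_sq] at parseval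
  have hn : (n : ℝ) ^ 2 / 4 ≠ 0 := by simp [NeZero.ne n]
  apply mul_left_cancel₀ hn
  linear_combination parseval

end Cosecant

/-! ### Sums over blocks of integers -/

section Blocks

theorem sum_range_mul_add {A : Type*} [AddCommMonoid A] (G : ℕ → ℕ → A) (K : ℕ) {M ρ : ℕ}
    (hM : 0 < M) (hρ : ρ ≤ M) :
    ∑ y ∈ Finset.range (K * M + ρ), G (y / M) (y % M) =
      ∑ z ∈ Finset.range K, ∑ x ∈ Finset.range M, G z x + ∑ x ∈ Finset.range ρ, G K x := by
  have hblock (z r : ℕ) (hr : r ≤ M) :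
      ∑ x ∈ Finset.range r, G ((z * M + x) / M) ((z * M + x) % M) =
        ∑ x ∈ Finset.range r, G z x := by
    refine Finset.sum_congr rfl fun x hx ↦ ?_
    have hx' : x < M := (Finset.mem_range.mp hx).trans_le hr
    rw [mul_comm z, Nat.mul_add_div hM, Nat.div_eq_of_lt hx', add_zero, Nat.mul_add_mod,
      Nat.mod_eq_of_lt hx']
  rw [Finset.sum_range_add, hblock K ρ hρ]
  congr 1
  induction K with
  | zero => simp
  | succ K ih => rw [Nat.succ_mul, Finset.sum_range_add, ih, hblock K M le_rfl,
      Finset.sum_range_succ]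

variable {M : ℕ}

theorem sum_range_pow_div {A : Type*} [Semiring A] (ζ : A) (hM : 0 < M) (r : ℕ) :
    ∑ y ∈ Finset.range r, ζ ^ (y / M) =
      M * ∑ z ∈ Finset.range (r / M), ζ ^ z + (r % M : ℕ) * ζ ^ (r / M) := by
  conv_lhs => rw [← Nat.div_add_mod' r M]
  rw [sum_range_mul_add (fun z _ ↦ ζ ^ z) _ hM (Nat.mod_lt _ hM).le]
  simp [Finset.mul_sum]

theorem sum_range_mul_pow_div {A : Type*} [Semiring A] {ζ : A} {n : ℕ} (hζ : ζ ^ n = 1)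
    (hsum : ∑ i ∈ Finset.range n, ζ ^ i = 0) (hn : 0 < n) (hM : 0 < M) (B : ℕ → A) (k : ℕ) :
    ∑ y ∈ Finset.range k, B (y / (n * M)) * ζ ^ (y / M) =
      B (k / (n * M)) * ∑ x ∈ Finset.range (k % (n * M)), ζ ^ (x / M) := by
  have hnM : 0 < n * M := Nat.mul_pos hn hM
  have hperiod : ∑ y ∈ Finset.range k, B (y / (n * M)) * ζ ^ (y / M) =
      ∑ y ∈ Finset.range k, B (y / (n * M)) * ζ ^ (y % (n * M) / M) :=
    Finset.sum_congr rfl fun y _ ↦ by rw [Nat.mod_mul_left_div_self, ← pow_eq_pow_mod _ hζ]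
  have hfull : ∑ x ∈ Finset.range (n * M), ζ ^ (x / M) = 0 := by
    rw [sum_range_pow_div ζ hM, Nat.mul_div_cancel _ hM, hsum, Nat.mul_mod_left]
    simp
  rw [hperiod]
  conv_lhs => rw [← Nat.div_add_mod' k (n * M)]
  rw [sum_range_mul_add (fun z x ↦ B z * ζ ^ (x / M)) _ hnM (Nat.mod_lt _ hnM).le]
  simp [← Finset.mul_sum, hfull]

theorem norm_sub_one_mul_norm_sum_range_pow_div_le {F : Type*} [NormedField F] [NormedAlgebra ℝ F]
    {ζ : F} (hζ : ‖ζ‖ = 1) (hM : 0 < M) (r : ℕ) :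
    ‖ζ - 1‖ * ‖∑ y ∈ Finset.range r, ζ ^ (y / M)‖ ≤ 2 * M := by
  have hρ : r % M ≤ M := (Nat.mod_lt _ hM).le
  have htelescope : (ζ - 1) * ∑ y ∈ Finset.range r, ζ ^ (y / M) =
      (M - r % M : ℕ) * (ζ ^ (r / M) - 1) + (r % M : ℕ) * (ζ ^ (r / M + 1) - 1) := by
    rw [sum_range_pow_div ζ hM, Nat.cast_sub hρ]
    linear_combination (M : F) * mul_geom_sum ζ (r / M)
  have hpow (j : ℕ) : ‖ζ ^ j - 1‖ ≤ 2 := by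
    refine (norm_sub_le _ _).trans ?_
    rw [norm_pow, hζ, one_pow, norm_one]
    norm_num
  have hcast (j : ℕ) : ‖(j : F)‖ = j := by
    rw [← map_natCast (algebraMap ℝ F), norm_algebraMap', Real.norm_natCast]
  calc ‖ζ - 1‖ * ‖∑ y ∈ Finset.range r, ζ ^ (y / M)‖
      ≤ (M - r % M : ℕ) * 2 + (r % M : ℕ) * 2 := by
        rw [← norm_mul, htelescope]
        refine (norm_add_le _ _).trans ?_
        rw [norm_mul, norm_mul, hcast, hcast]
        gcongr <;> exact hpow _
    _ = 2 * M := by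
        rw [Nat.cast_sub hρ]
        ring

end Blocks

/-! ### Digits -/

section Digits

variable {p : ℕ} [NeZero p] {m : ℕ}

theorem finEquiv_apply (x : Fin p) : ZMod.finEquiv p x = ((x : ℕ) : ZMod p) := by
  obtain ⟨n, rfl⟩ := Nat.exists_eq_succ_of_ne_zero (NeZero.ne p)
  exact (Fin.cast_val_eq_self x).symm

theorem finEquiv_symm_val (x : ZMod p) : ((ZMod.finEquiv p).symm x : ℕ) = x.val := by
  obtain ⟨y, rfl⟩ := (ZMod.finEquiv p).surjective x
  rw [RingEquiv.symm_apply_apply, finEquiv_apply, ZMod.val_cast_of_lt y.2]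

variable (p m) in
/-- The base `p` digits of `n < p ^ m`, least significant first, read in `ZMod p`. -/
def digitEquiv : Fin (p ^ m) ≃ (Fin m → ZMod p) :=
  finFunctionFinEquiv.symm.trans (Equiv.arrowCongr (Equiv.refl _) (ZMod.finEquiv p).toEquiv)

theorem digitEquiv_apply (n : Fin (p ^ m)) (r : Fin m) :
    digitEquiv p m n r = ((n / p ^ (r : ℕ) : ℕ) : ZMod p) := by
  change ZMod.finEquiv p (finFunctionFinEquiv.symm n r) = _
  rw [finEquiv_apply, finFunctionFinEquiv_symm_apply_val, ZMod.natCast_mod]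

theorem digitEquiv_symm_val (c : Fin m → ZMod p) :
    ((digitEquiv p m).symm c : ℕ) = ∑ i, (c i).val * p ^ (i : ℕ) := by
  change (finFunctionFinEquiv fun i ↦ (ZMod.finEquiv p).symm (c i) : ℕ) = _
  simp_rw [finFunctionFinEquiv_apply, finEquiv_symm_val]

theorem eq_of_digits_eq {x y : ℕ} (hx : x < p ^ m) (hy : y < p ^ m)
    (h : ∀ r : Fin m, ((x / p ^ (r : ℕ) : ℕ) : ZMod p) = ((y / p ^ (r : ℕ) : ℕ) : ZMod p)) :
    x = y := by
  have : digitEquiv p m ⟨x, hx⟩ = digitEquiv p m ⟨y, hy⟩ := by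
    ext r
    simp_rw [digitEquiv_apply, h r]
  simpa using (digitEquiv p m).injective this

end Digits

/-! ### Walsh coefficients of initial segments -/

section Walsh

variable {p : ℕ} {m : ℕ} {h : (ZMod p)[X]}

variable (p m h) in
/-- The exponent `⟨h, y⟩` of the Walsh function `wal_h` at `y / p ^ m`: the coefficients of `h`,
lowest degree first, are paired with the base `p` digits of `y < p ^ m`, most significant digit
first. -/
def digitPairing (y : ℕ) : ZMod p :=
  ∑ i : Fin m, h.coeff i * ((y / p ^ (i.rev : ℕ) : ℕ) : ZMod p)

variable [NeZero p]

variable (p m h) in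
/-- The Walsh coefficient at `h` of the indicator of `{0, …, k - 1}` in `{0, …, p ^ m - 1}`. -/
def walshCoeff (k : ℕ) : ℂ :=
  (∑ y ∈ Finset.range k, ZMod.stdAddChar (-digitPairing p m h y)) / (p : ℂ) ^ m

theorem walshCoeff_zero (k : ℕ) : walshCoeff p m 0 k = k / (p : ℂ) ^ m := by
  simp [walshCoeff, digitPairing]

theorem exists_stdAddChar_neg_digitPairing_eq (hdeg : h.natDegree < m) :
    ∃ B : ℕ → ℂ, (∀ z, ‖B z‖ = 1) ∧
      ∀ y, ZMod.stdAddChar (-digitPairing p m h y) =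
        B (y / (p * p ^ (m - (h.natDegree + 1)))) *
          ZMod.stdAddChar (-h.leadingCoeff) ^ (y / p ^ (m - (h.natDegree + 1))) := by
  refine ⟨fun z ↦ ZMod.stdAddChar (-∑ i ∈ Finset.range h.natDegree, h.coeff i *
    ((z / p ^ (h.natDegree - (i + 1)) : ℕ) : ZMod p)), fun z ↦ AddChar.norm_apply _ _, fun y ↦ ?_⟩
  rw [← AddChar.map_nsmul_eq_pow, ← AddChar.map_add_eq_mul]
  congr 1
  simp only [digitPairing, Fin.val_rev]
  rw [Fin.sum_univ_eq_sum_range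
      (fun i ↦ h.coeff i * ((y / p ^ (m - (i + 1)) : ℕ) : ZMod p)) m,
    ← Finset.sum_subset (Finset.range_subset_range.mpr (Nat.succ_le_of_lt hdeg)),
    Finset.sum_range_succ, neg_add, coeff_natDegree, nsmul_eq_mul, mul_neg, mul_comm h.leadingCoeff]
  · congr 2
    refine Finset.sum_congr rfl fun i hi ↦ ?_
    have hi' := Finset.mem_range.mp hi
    rw [Nat.div_div_eq_div_mul, mul_assoc, ← pow_add, ← pow_succ',
      show m - (h.natDegree + 1) + (h.natDegree - (i + 1)) + 1 = m - (i + 1) by omega]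
  · intro i _ hi
    rw [coeff_eq_zero_of_natDegree_lt (by simpa [Nat.succ_le_iff] using hi), zero_mul]

theorem exists_walshCoeff_eq (h0 : h ≠ 0) (hdeg : h.natDegree < m) (k : ℕ) :
    ∃ b : ℂ, ‖b‖ = 1 ∧ walshCoeff p m h k =
      b * (∑ x ∈ Finset.range (k % (p * p ^ (m - (h.natDegree + 1)))),
        ZMod.stdAddChar (-h.leadingCoeff) ^ (x / p ^ (m - (h.natDegree + 1)))) / (p : ℂ) ^ m := by
  obtain ⟨B, hB, hfactor⟩ := exists_stdAddChar_neg_digitPairing_eq hdeg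
  have hlc : -h.leadingCoeff ≠ 0 := neg_ne_zero.mpr (leadingCoeff_ne_zero.mpr h0)
  have hζ := stdAddChar_pow_eq_one (-h.leadingCoeff)
  have hp := NeZero.pos p
  refine ⟨_, hB (k / (p * p ^ (m - (h.natDegree + 1)))), ?_⟩
  simp_rw [walshCoeff, hfactor]
  rw [sum_range_mul_pow_div hζ
    (geom_sum_eq_zero_of_pow_eq_one hζ (stdAddChar_eq_one_iff.not.mpr hlc)) hp (pow_pos hp _)]

theorem walshCoeff_pow (h0 : h ≠ 0) (hdeg : h.natDegree < m) : walshCoeff p m h (p ^ m) = 0 := by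
  obtain ⟨b, -, hcoeff⟩ := exists_walshCoeff_eq h0 hdeg (p ^ m)
  have hdvd : p * p ^ (m - (h.natDegree + 1)) ∣ p ^ m := by
    rw [← pow_succ']
    exact pow_dvd_pow p (by omega)
  rw [hcoeff, Nat.mod_eq_zero_of_dvd hdvd]
  simp

theorem norm_walshCoeff_le (h0 : h ≠ 0) (hdeg : h.natDegree < m) (k : ℕ) :
    ‖walshCoeff p m h k‖ ≤ rho p h := by
  obtain ⟨b, hb, hcoeff⟩ := exists_walshCoeff_eq h0 hdeg k
  have hp : (0 : ℝ) < p := Nat.cast_pos.mpr (NeZero.pos p)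
  set M := p ^ (m - (h.natDegree + 1)) with hM
  set S := ∑ x ∈ Finset.range (k % (p * M)), ZMod.stdAddChar (-h.leadingCoeff) ^ (x / M)
  set σ := Real.sin (Real.pi / p * h.leadingCoeff.val)
  have hσ : σ ≠ 0 := sin_pi_div_mul_val_ne_zero (leadingCoeff_ne_zero.mpr h0)
  have hS : |σ| * ‖S‖ ≤ (p : ℝ) ^ (m - (h.natDegree + 1)) := by
    have := norm_sub_one_mul_norm_sum_range_pow_div_le
      (AddChar.norm_apply ZMod.stdAddChar (-h.leadingCoeff)) (pow_pos (NeZero.pos p) _)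
      (M := M) (k % (p * M))
    rw [norm_stdAddChar_neg_sub_one, hM, Nat.cast_pow] at this
    linarith
  have hpow : (p : ℝ) ^ m = p ^ (h.natDegree + 1) * p ^ (m - (h.natDegree + 1)) := by
    rw [← pow_add, Nat.add_sub_cancel' hdeg]
  rw [hcoeff, norm_div, norm_mul, hb, one_mul, norm_pow, Complex.norm_natCast, rho, hpow,
    div_le_div_iff₀ (by positivity) (by positivity), one_mul]
  calc ‖S‖ * (p ^ (h.natDegree + 1) * σ ^ 2)
      = p ^ (h.natDegree + 1) * (|σ| * (|σ| * ‖S‖)) := by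
        rw [← sq_abs σ]
        ring
    _ ≤ p ^ (h.natDegree + 1) * (1 * p ^ (m - (h.natDegree + 1))) := by
        gcongr
        exact Real.abs_sin_le_one _
    _ = _ := by rw [one_mul]

end Walsh

/-! ### Walsh inversion -/

section WalshInversion

variable {p : ℕ} [Fact p.Prime] {m : ℕ}

theorem sum_degreeLT_stdAddChar (e : Fin m → ZMod p) :
    ∑ h : degreeLT (ZMod p) m, ZMod.stdAddChar (∑ i : Fin m, (h : (ZMod p)[X]).coeff i * e i) =
      if e = 0 then (p : ℂ) ^ m else 0 := by
  have hdot := sum_stdAddChar_dotProduct e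
  rw [Fintype.card_fin] at hdot
  rw [← hdot]
  exact Fintype.sum_equiv (degreeLTEquiv (ZMod p) m).toEquiv _ _ fun h ↦ rfl

theorem sum_stdAddChar_digitPairing_sub {x y : ℕ} (hx : x < p ^ m) (hy : y < p ^ m) :
    ∑ h : degreeLT (ZMod p) m, ZMod.stdAddChar (-digitPairing p m h x + digitPairing p m h y) =
      if x = y then (p : ℂ) ^ m else 0 := by
  set e : Fin m → ZMod p := fun i ↦
    ((y / p ^ (i.rev : ℕ) : ℕ) : ZMod p) - ((x / p ^ (i.rev : ℕ) : ℕ) : ZMod p) with he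
  have hpair (h : (ZMod p)[X]) :
      -digitPairing p m h x + digitPairing p m h y = ∑ i : Fin m, h.coeff i * e i := by
    simp only [digitPairing, he, mul_sub, Finset.sum_sub_distrib]
    ring
  have hzero : e = 0 ↔ x = y := by
    refine ⟨fun h ↦ eq_of_digits_eq hx hy fun r ↦ ?_, fun h ↦ by
      ext
      simp [he, h]⟩
    have := congrFun h r.rev
    simp only [he, Fin.rev_rev, Pi.zero_apply, sub_eq_zero] at this
    exact this.symm
  simp_rw [hpair, sum_degreeLT_stdAddChar, hzero]

theorem sum_walshCoeff_mul_stdAddChar {k y : ℕ} (hk : k ≤ p ^ m) (hy : y < p ^ m) :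
    ∑ h : degreeLT (ZMod p) m, walshCoeff p m h k * ZMod.stdAddChar (digitPairing p m h y) =
      if y < k then 1 else 0 := by
  have hp : (p : ℂ) ^ m ≠ 0 := pow_ne_zero _ (NeZero.ne _)
  simp_rw [walshCoeff, div_mul_eq_mul_div, Finset.sum_mul, ← AddChar.map_add_eq_mul]
  rw [← Finset.sum_div, Finset.sum_comm, Finset.sum_congr rfl fun x hx ↦
    sum_stdAddChar_digitPairing_sub ((Finset.mem_range.mp hx).trans_le hk) hy]
  split_ifs with hyk <;> simp [hyk, hp]

end WalshInversion

/-! ### Laurent series in `x⁻¹` -/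

section Laurent

variable {p : ℕ} [Fact p.Prime]

theorem toLaurent_monomial (i : ℕ) (c : ZMod p) :
    toLaurent p (monomial i c) = HahnSeries.single (-(i : ℤ)) c := by
  rw [toLaurent, aeval_monomial,
    RingHom.congr_fun (Subsingleton.elim (algebraMap _ _) HahnSeries.C) c, HahnSeries.C_apply,
    HahnSeries.single_pow, HahnSeries.single_mul_single]
  simp

theorem coeff_toLaurent_mul (h : (ZMod p)[X]) (L : LaurentSeries (ZMod p)) (l : ℤ) :
    (toLaurent p h * L).coeff l = h.sum fun i c ↦ c * L.coeff (l + i) := by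
  induction h using Polynomial.induction_on' with
  | add h₁ h₂ ih₁ ih₂ =>
    rw [map_add, add_mul, HahnSeries.coeff_add, ih₁, ih₂,
      sum_add_index _ _ _ (fun _ ↦ zero_mul _) fun _ _ _ ↦ add_mul _ _ _]
  | monomial i c =>
    rw [toLaurent_monomial, HahnSeries.coeff_single_mul, sub_neg_eq_add,
      sum_monomial_index c (fun i c ↦ c * L.coeff (l + i)) (zero_mul _)]

theorem coeff_toLaurent_mul_of_degree_lt {m : ℕ} {h : (ZMod p)[X]} (hh : h.degree < m)
    (L : LaurentSeries (ZMod p)) (l : ℤ) :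
    (toLaurent p h * L).coeff l = ∑ i : Fin m, h.coeff i * L.coeff (l + i) := by
  rw [coeff_toLaurent_mul, ← sum_fin (fun i c ↦ c * L.coeff (l + i)) (fun _ ↦ zero_mul _) hh]

theorem coeff_toLaurent_neg (h : (ZMod p)[X]) (i : ℕ) :
    (toLaurent p h).coeff (-(i : ℤ)) = h.coeff i := by
  rw [← mul_one (toLaurent p h), coeff_toLaurent_mul, sum_def]
  simp [HahnSeries.coeff_one, neg_add_eq_zero, eq_comm]

theorem coeff_toLaurent_of_pos (h : (ZMod p)[X]) {l : ℤ} (hl : 0 < l) :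
    (toLaurent p h).coeff l = 0 := by
  rw [← mul_one (toLaurent p h), coeff_toLaurent_mul]
  refine Finset.sum_eq_zero fun i _ ↦ ?_
  simp only
  rw [HahnSeries.coeff_one, if_neg (by omega), mul_zero]

theorem toLaurent_ne_zero {h : (ZMod p)[X]} (h0 : h ≠ 0) : toLaurent p h ≠ 0 := fun e ↦ h0 <| by
  ext i
  rw [← coeff_toLaurent_neg, e, HahnSeries.coeff_zero, coeff_zero]

theorem order_toLaurent {h : (ZMod p)[X]} (h0 : h ≠ 0) :
    (toLaurent p h).order = -(h.natDegree : ℤ) := by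
  refine le_antisymm (HahnSeries.order_le_of_coeff_ne_zero ?_)
    ((HahnSeries.le_order_iff_forall (toLaurent_ne_zero h0)).mpr fun j hj ↦ ?_)
  · rwa [coeff_toLaurent_neg, coeff_natDegree, leadingCoeff_ne_zero]
  · rw [show j = -(j.natAbs : ℤ) by omega, coeff_toLaurent_neg]
    exact coeff_eq_zero_of_natDegree_lt (by omega)

theorem order_toLaurent_div {f Q : (ZMod p)[X]} (hf : f ≠ 0) (hQ : Q ≠ 0) :
    (toLaurent p Q / toLaurent p f).order = f.natDegree - Q.natDegree := by
  have hF := toLaurent_ne_zero hf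
  have := HahnSeries.order_mul (div_ne_zero (toLaurent_ne_zero hQ) hF) hF
  rw [div_mul_cancel₀ _ hF, order_toLaurent hQ, order_toLaurent hf] at this
  omega

theorem coeff_toLaurent_div_eq_mod {f : (ZMod p)[X]} (hf : f ≠ 0) (Q : (ZMod p)[X]) {l : ℤ}
    (hl : 0 < l) : (toLaurent p Q / toLaurent p f).coeff l =
      (toLaurent p (Q % f) / toLaurent p f).coeff l := by
  conv_lhs => rw [← EuclideanDomain.div_add_mod Q f]
  rw [map_add, map_mul, add_div, mul_div_cancel_left₀ _ (toLaurent_ne_zero hf),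
    HahnSeries.coeff_add, coeff_toLaurent_of_pos _ hl, zero_add]

theorem dvd_iff_coeff_toLaurent_div_eq_zero {f : (ZMod p)[X]} (hf : f ≠ 0) (Q : (ZMod p)[X]) :
    f ∣ Q ↔ ∀ r : Fin f.natDegree, (toLaurent p Q / toLaurent p f).coeff (1 + r) = 0 := by
  simp_rw [coeff_toLaurent_div_eq_mod hf Q (show (0 : ℤ) < 1 + (_ : ℕ) by positivity)]
  rw [← EuclideanDomain.mod_eq_zero]
  refine ⟨fun h r ↦ by simp [h], fun h ↦ ?_⟩
  by_contra hB
  have hdeg : (Q % f).natDegree < f.natDegree :=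
    natDegree_lt_natDegree hB (EuclideanDomain.mod_lt Q hf)
  have horder := order_toLaurent_div hf hB
  refine div_ne_zero (toLaurent_ne_zero hB) (toLaurent_ne_zero hf)
    (HahnSeries.coeff_order_eq_zero.mp ?_)
  rw [← h ⟨f.natDegree - (Q % f).natDegree - 1, by omega⟩]
  congr 1
  rw [horder]
  dsimp only
  omega

end Laurent

/-! ### Polynomial lattice points -/

section LatticePoints

theorem natPoly_degree_lt {p m : ℕ} (n : ℕ) : (natPoly p m n).degree < m := by
  rw [natPoly, ← mem_degreeLT]
  refine Submodule.sum_mem _ fun i hi ↦ mem_degreeLT.mpr ?_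
  exact (degree_C_mul_X_pow_le _ _).trans_lt (WithBot.coe_lt_coe.mpr (Finset.mem_range.mp hi))

variable {p : ℕ} [Fact p.Prime] {m : ℕ}

variable (m) in
/-- The integer `p ^ m * φ_m(L)`. -/
def phiNum (L : LaurentSeries (ZMod p)) : Fin (p ^ m) :=
  (digitEquiv p m).symm fun i ↦ L.coeff (1 + i.rev)

theorem phi_eq_phiNum_div (L : LaurentSeries (ZMod p)) :
    phi p m L = (phiNum m L : ℕ) / (p : ℝ) ^ m := by
  have hp : (p : ℝ) ≠ 0 := NeZero.ne _
  rw [phi, phiNum, digitEquiv_symm_val, Nat.cast_sum, Finset.sum_div,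
    ← Finset.Ico_add_one_right_eq_Icc, Finset.sum_Ico_eq_sum_range, Nat.add_sub_cancel,
    ← Fin.sum_univ_eq_sum_range, ← Equiv.sum_comp Fin.revPerm]
  refine Finset.sum_congr rfl fun i _ ↦ ?_
  have hpow : (p : ℝ) ^ m = p ^ (1 + i.rev : ℕ) * p ^ (i : ℕ) := by
    rw [← pow_add, Fin.val_rev]
    congr 1
    omega
  rw [hpow, Fin.revPerm_apply]
  push_cast
  field_simp

theorem digitPairing_phiNum {h : (ZMod p)[X]} (hh : h.degree < m) (L : LaurentSeries (ZMod p)) :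
    digitPairing p m h (phiNum m L) = (toLaurent p h * L).coeff 1 := by
  rw [coeff_toLaurent_mul_of_degree_lt hh, digitPairing]
  refine Finset.sum_congr rfl fun i _ ↦ ?_
  rw [← digitEquiv_apply (phiNum m L) i.rev, phiNum, Equiv.apply_symm_apply, Fin.rev_rev]

theorem natPoly_coeff (n : Fin (p ^ m)) (r : Fin m) :
    (natPoly p m n).coeff r = digitEquiv p m n r := by
  simp [natPoly, coeff_X_pow, digitEquiv_apply]

variable {s : ℕ}

variable (m) in
/-- The integers `p ^ m * x_{n,j}` for the points `x_n` of the polynomial lattice `P(q, f)`. -/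
def latticeNum (q : Fin s → (ZMod p)[X]) (f : (ZMod p)[X]) (n : Fin (p ^ m)) (j : Fin s) :
    Fin (p ^ m) :=
  phiNum m (toLaurent p (natPoly p m n * q j) / toLaurent p f)

theorem latticePoint_apply (q : Fin s → (ZMod p)[X]) (f : (ZMod p)[X]) (n : Fin (p ^ m))
    (j : Fin s) : latticePoint p m q f n j = (latticeNum m q f n j : ℕ) / ((p ^ m : ℕ) : ℝ) := by
  rw [Nat.cast_pow]
  exact phi_eq_phiNum_div _

theorem sum_digitPairing_latticeNum (q : Fin s → (ZMod p)[X]) (f : (ZMod p)[X])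
    (h : Fin s → degreeLT (ZMod p) m) (n : Fin (p ^ m)) :
    ∑ j, digitPairing p m (h j) (latticeNum m q f n j) =
      ∑ r : Fin m, digitEquiv p m n r *
        (toLaurent p (∑ j, (h j : (ZMod p)[X]) * q j) / toLaurent p f).coeff (1 + r) := by
  simp_rw [← natPoly_coeff]
  rw [← coeff_toLaurent_mul_of_degree_lt (natPoly_degree_lt n), map_sum, Finset.sum_div,
    Finset.mul_sum, HahnSeries.coeff_sum]
  refine Finset.sum_congr rfl fun j _ ↦ ?_
  rw [latticeNum, digitPairing_phiNum (mem_degreeLT.mp (h j).2), map_mul, map_mul]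
  congr 1
  ring

open Classical in
theorem sum_prod_stdAddChar_latticeNum {f : (ZMod p)[X]} (hf : f ≠ 0) (hfm : f.natDegree = m)
    (q : Fin s → (ZMod p)[X]) (h : Fin s → degreeLT (ZMod p) m) :
    ∑ n, ∏ j, ZMod.stdAddChar (digitPairing p m (h j) (latticeNum m q f n j)) =
      if f ∣ ∑ j, (h j : (ZMod p)[X]) * q j then (p : ℂ) ^ m else 0 := by
  subst hfm
  simp_rw [← stdAddChar_sum, sum_digitPairing_latticeNum]
  set e : Fin f.natDegree → ZMod p := fun r ↦
    (toLaurent p (∑ j, (h j : (ZMod p)[X]) * q j) / toLaurent p f).coeff (1 + r)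
  have hdot := sum_stdAddChar_dotProduct e
  rw [Fintype.card_fin] at hdot
  rw [(digitEquiv p f.natDegree).sum_comp fun c ↦ ZMod.stdAddChar (∑ r, c r * e r), hdot]
  simp_rw [dvd_iff_coeff_toLaurent_div_eq_zero hf, e, funext_iff, Pi.zero_apply]

end LatticePoints

/-! ### Products and rounding -/

section Rounding

theorem prod_sub_prod_le {ι : Type*} (u : Finset ι) (a b : ι → ℝ) {δ : ℝ} (hδ1 : δ ≤ 1)
    (hb : ∀ j ∈ u, 0 ≤ b j) (hba : ∀ j ∈ u, b j ≤ a j) (ha : ∀ j ∈ u, a j ≤ 1)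
    (hd : ∀ j ∈ u, a j - b j ≤ δ) :
    ∏ j ∈ u, a j - ∏ j ∈ u, b j ≤ 1 - (1 - δ) ^ u.card := by
  classical
  induction u using Finset.induction_on with
  | empty => simp
  | insert i u hi ih =>
    simp only [Finset.mem_insert, forall_eq_or_imp] at hb hba ha hd
    have ih := ih hb.2 hba.2 ha.2 hd.2
    rw [Finset.prod_insert hi, Finset.prod_insert hi, Finset.card_insert_of_notMem hi, pow_succ]
    have hA1 : ∏ j ∈ u, a j ≤ 1 :=
      Finset.prod_le_one (fun j hj ↦ (hb.2 j hj).trans (hba.2 j hj)) ha.2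
    have hBA : ∏ j ∈ u, b j ≤ ∏ j ∈ u, a j := Finset.prod_le_prod hb.2 hba.2
    have hB : 0 ≤ ∏ j ∈ u, b j := Finset.prod_nonneg hb.2
    set A := ∏ j ∈ u, a j
    set B := ∏ j ∈ u, b j
    have hstep : a i * A - b i * B ≤ 1 - (1 - (A - B)) * (1 - (a i - b i)) := by
      nlinarith [mul_nonneg (sub_nonneg.mpr hBA) (sub_nonneg.mpr ha.1),
        mul_nonneg (sub_nonneg.mpr hba.1) (sub_nonneg.mpr hA1)]
    have hpow : (1 - δ) ^ u.card * (1 - δ) ≤ (1 - (A - B)) * (1 - (a i - b i)) :=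
      mul_le_mul (by linarith) (by linarith [hd.1]) (by linarith) (by linarith)
    linarith

/-- The least element of `(1 / N) ℕ` that is at least `t`. -/
def roundUp (N : ℕ) (t : ℝ) : ℝ := ⌈t * N⌉₊ / N

variable {N : ℕ} {t : ℝ}

theorem ceil_mul_le (ht : t ≤ 1) : ⌈t * N⌉₊ ≤ N :=
  Nat.ceil_le.mpr (mul_le_of_le_one_left N.cast_nonneg ht)

theorem roundUp_le_one (ht : t ≤ 1) : roundUp N t ≤ 1 :=
  div_le_one_of_le₀ (Nat.cast_le.mpr (ceil_mul_le ht)) N.cast_nonneg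

variable [NeZero N]

theorem roundUp_one : roundUp N 1 = 1 := by
  rw [roundUp, one_mul, Nat.ceil_natCast, div_self (NeZero.ne _)]

theorem le_roundUp : t ≤ roundUp N t := by
  rw [roundUp, le_div_iff₀ (Nat.cast_pos.mpr (NeZero.pos N))]
  exact Nat.le_ceil _

theorem roundUp_sub_le (ht : 0 ≤ t) : roundUp N t - t ≤ 1 / N := by
  have hN : (0 : ℝ) < N := Nat.cast_pos.mpr (NeZero.pos N)
  have := (Nat.ceil_lt_add_one (mul_nonneg ht hN.le)).le
  rw [roundUp, sub_le_iff_le_add, div_le_iff₀ hN, add_mul, div_mul_cancel₀ _ hN.ne']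
  linarith

variable {s : ℕ}

theorem roundUp_comp_fillOne (u : Finset (Fin s)) (t : Fin s → ℝ) :
    (fun j ↦ roundUp N (fillOne u t j)) = fillOne u fun j ↦ roundUp N (t j) := by
  ext j
  simp only [fillOne, apply_ite (roundUp N), roundUp_one]

theorem prod_fillOne (u : Finset (Fin s)) (t : Fin s → ℝ) :
    ∏ j, fillOne u t j = ∏ j ∈ u, t j := by
  simp only [fillOne, Finset.prod_ite_mem, Finset.univ_inter]

theorem abs_prod_roundUp_fillOne_sub_le {t : Fin s → ℝ} (ht0 : ∀ j, 0 ≤ t j) (ht1 : ∀ j, t j ≤ 1)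
    (u : Finset (Fin s)) :
    |∏ j, roundUp N (fillOne u t j) - ∏ j, fillOne u t j| ≤ 1 - (1 - 1 / (N : ℝ)) ^ u.card := by
  have hN : 1 / (N : ℝ) ≤ 1 :=
    div_le_one_of_le₀ (Nat.one_le_cast.mpr (NeZero.one_le (n := N))) N.cast_nonneg
  rw [Finset.prod_congr rfl fun j _ ↦ congrFun (roundUp_comp_fillOne u t) j, prod_fillOne,
    prod_fillOne, abs_of_nonneg (sub_nonneg.mpr
      (Finset.prod_le_prod (fun j _ ↦ ht0 j) fun j _ ↦ le_roundUp))]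
  exact prod_sub_prod_le u _ _ hN (fun j _ ↦ ht0 j) (fun j _ ↦ le_roundUp)
    (fun j _ ↦ roundUp_le_one (ht1 j)) fun j _ ↦ roundUp_sub_le (ht0 j)

end Rounding

/-! ### The local discrepancy of a polynomial lattice -/

section Discrepancy

section Rho

variable {p : ℕ} {γ : ℝ}

theorem rho_nonneg (h : (ZMod p)[X]) : 0 ≤ rho p h := by
  rw [rho]
  positivity

theorem rhoW_of_ne_zero {h : (ZMod p)[X]} (h0 : h ≠ 0) : rhoW p h γ = γ * rho p h :=
  if_neg h0

theorem rhoW_zero : rhoW p 0 γ = 1 + γ :=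
  if_pos rfl

theorem rhoW_nonneg (h : (ZMod p)[X]) (hγ : 0 ≤ γ) : 0 ≤ rhoW p h γ := by
  rcases eq_or_ne h 0 with rfl | h0
  · rw [rhoW_zero]
    positivity
  · rw [rhoW_of_ne_zero h0]
    exact mul_nonneg hγ (rho_nonneg h)

end Rho

variable {p : ℕ} [Fact p.Prime] {m : ℕ} {s : ℕ}

theorem R_nonneg {γ : Fin s → ℝ} (hγ : ∀ i, 0 ≤ γ i) (q : Fin s → (ZMod p)[X]) (f : (ZMod p)[X]) :
    0 ≤ R p m γ q f :=
  Finset.sum_nonneg fun _ _ ↦ Finset.prod_nonneg fun i _ ↦ rhoW_nonneg _ (hγ i)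

theorem mul_norm_walshCoeff_le_rhoW (h : degreeLT (ZMod p) m) {γ : ℝ} (hγ : 0 ≤ γ) {k : ℕ}
    (hk : k ≤ p ^ m) : γ * ‖walshCoeff p m h k‖ ≤ rhoW p h γ := by
  rcases eq_or_ne (h : (ZMod p)[X]) 0 with h0 | h0
  · rw [h0, rhoW_zero, walshCoeff_zero, norm_div, norm_pow, Complex.norm_natCast,
      Complex.norm_natCast]
    have : (k : ℝ) / (p : ℝ) ^ m ≤ 1 :=
      div_le_one_of_le₀ (by exact_mod_cast hk) (by positivity)
    exact (mul_le_of_le_one_right hγ this).trans (le_add_of_nonneg_left zero_le_one)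
  · rw [rhoW_of_ne_zero h0]
    have hdeg := (natDegree_lt_iff_degree_lt h0).mpr (mem_degreeLT.mp h.2)
    exact mul_le_mul_of_nonneg_left (norm_walshCoeff_le h0 hdeg k) hγ

theorem norm_walshCoeff_pow_le_rhoW (h : degreeLT (ZMod p) m) {γ : ℝ} (hγ : 0 ≤ γ) :
    ‖walshCoeff p m h (p ^ m)‖ ≤ rhoW p h γ := by
  rcases eq_or_ne (h : (ZMod p)[X]) 0 with h0 | h0
  · have hp : (p : ℂ) ^ m ≠ 0 := pow_ne_zero _ (NeZero.ne _)
    rw [h0, rhoW_zero, walshCoeff_zero, Nat.cast_pow, div_self hp, norm_one]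
    exact le_add_of_nonneg_right hγ
  · have hdeg := (natDegree_lt_iff_degree_lt h0).mpr (mem_degreeLT.mp h.2)
    rw [walshCoeff_pow h0 hdeg, norm_zero]
    exact rhoW_nonneg _ hγ

theorem latticePoint_mem_box_iff (q : Fin s → (ZMod p)[X]) (f : (ZMod p)[X]) (t : Fin s → ℝ)
    (n : Fin (p ^ m)) : latticePoint p m q f n ∈ box t ↔
      ∀ j, (latticeNum m q f n j : ℕ) < ⌈t j * (p ^ m : ℕ)⌉₊ := by
  have hp : (0 : ℝ) < (p ^ m : ℕ) := Nat.cast_pos.mpr (NeZero.pos _)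
  simp only [box, Set.mem_univ_pi, latticePoint_apply, Set.mem_Ico, Nat.lt_ceil, div_lt_iff₀ hp]
  exact forall_congr' fun j ↦ and_iff_right (by positivity)

theorem localDisc_eq_localDisc_roundUp (q : Fin s → (ZMod p)[X]) (f : (ZMod p)[X])
    (t : Fin s → ℝ) :
    localDisc (latticePoint p m q f) t =
      localDisc (latticePoint p m q f) (fun j ↦ roundUp (p ^ m) (t j)) +
        (∏ j, roundUp (p ^ m) (t j) - ∏ j, t j) := by
  have hp : ((p ^ m : ℕ) : ℝ) ≠ 0 := NeZero.ne _
  have hind (n : Fin (p ^ m)) : (box fun j ↦ roundUp (p ^ m) (t j)).indicator (fun _ ↦ (1 : ℝ))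
      (latticePoint p m q f n) = (box t).indicator (fun _ ↦ 1) (latticePoint p m q f n) := by
    refine Set.indicator_eq_indicator ?_ rfl
    simp only [latticePoint_mem_box_iff, roundUp, div_mul_cancel₀ _ hp, Nat.ceil_natCast]
  simp only [localDisc, hind]
  ring

theorem indicator_eq_sum_walshCoeff {k y : Fin s → ℕ} (hk : ∀ j, k j ≤ p ^ m)
    (hy : ∀ j, y j < p ^ m) :
    (if ∀ j, y j < k j then (1 : ℂ) else 0) =
      ∑ h : Fin s → degreeLT (ZMod p) m, (∏ j, walshCoeff p m (h j) (k j)) *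
        ∏ j, ZMod.stdAddChar (digitPairing p m (h j) (y j)) := by
  simp_rw [← Finset.prod_mul_distrib]
  rw [← Fintype.prod_sum fun j (h : degreeLT (ZMod p) m) ↦
    walshCoeff p m h (k j) * ZMod.stdAddChar (digitPairing p m h (y j))]
  simp_rw [sum_walshCoeff_mul_stdAddChar (hk _) (hy _)]
  simp [Finset.prod_ite_zero]

open Classical in
theorem localDisc_latticePoint_natCast_div {f : (ZMod p)[X]} (hf : f ≠ 0) (hfm : f.natDegree = m)
    (q : Fin s → (ZMod p)[X]) {k : Fin s → ℕ} (hk : ∀ j, k j ≤ p ^ m) :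
    (localDisc (latticePoint p m q f) (fun j ↦ k j / (p ^ m : ℕ)) : ℂ) =
      ∑ h : Fin s → degreeLT (ZMod p) m with h ≠ 0 ∧ f ∣ ∑ j, (h j : (ZMod p)[X]) * q j,
        ∏ j, walshCoeff p m (h j) (k j) := by
  have hpR : ((p ^ m : ℕ) : ℝ) ≠ 0 := NeZero.ne _
  have hpC : (p : ℂ) ^ m ≠ 0 := pow_ne_zero _ (NeZero.ne _)
  have hcount : ∑ n, (((box fun j ↦ k j / (p ^ m : ℕ)).indicator (fun _ ↦ (1 : ℝ))
        (latticePoint p m q f n) : ℝ) : ℂ) =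
      p ^ m * ∑ h : Fin s → degreeLT (ZMod p) m with f ∣ ∑ j, (h j : (ZMod p)[X]) * q j,
        ∏ j, walshCoeff p m (h j) (k j) := by
    simp only [Set.indicator, latticePoint_mem_box_iff, div_mul_cancel₀ _ hpR,
      Nat.ceil_natCast, apply_ite Complex.ofReal, Complex.ofReal_one, Complex.ofReal_zero,
      indicator_eq_sum_walshCoeff hk fun j ↦ (latticeNum m q f _ j).2]
    rw [Finset.sum_comm, Finset.mul_sum, Finset.sum_filter]
    refine Finset.sum_congr rfl fun h _ ↦ ?_
    rw [← Finset.mul_sum, sum_prod_stdAddChar_latticeNum hf hfm]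
    split_ifs <;> ring
  have hzero : ∏ j, walshCoeff p m ((0 : Fin s → degreeLT (ZMod p) m) j) (k j) =
      ∏ j, (k j : ℂ) / p ^ m := by
    simp only [Pi.zero_apply, ZeroMemClass.coe_zero, walshCoeff_zero]
  simp only [localDisc, Complex.ofReal_sub, Complex.ofReal_mul, Complex.ofReal_sum,
    Complex.ofReal_prod, Complex.ofReal_div, Complex.ofReal_one, Complex.ofReal_natCast]
  rw [hcount, Nat.cast_pow, ← hzero, one_div, inv_mul_cancel_left₀ hpC, sub_eq_iff_eq_add,
    ← Finset.filter_filter, Finset.filter_ne', Finset.filter_erase,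
    Finset.sum_erase_add _ _ (by simp)]

theorem prodWeight_mul_abs_localDisc_natCast_div_le {f : (ZMod p)[X]} (hf : f ≠ 0)
    (hfm : f.natDegree = m) (q : Fin s → (ZMod p)[X]) {γ : Fin s → ℝ} (hγ : ∀ i, 0 ≤ γ i)
    (u : Finset (Fin s)) {k : Fin s → ℕ} (hk : ∀ j, k j ≤ p ^ m) (hku : ∀ j ∉ u, k j = p ^ m) :
    prodWeight γ u * |localDisc (latticePoint p m q f) (fun j ↦ k j / (p ^ m : ℕ))| ≤
      R p m γ q f := by
  have hweight : prodWeight γ u = ∏ j, if j ∈ u then γ j else 1 := by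
    rw [prodWeight, Finset.prod_ite_mem, Finset.univ_inter]
  have hweight0 (j : Fin s) : 0 ≤ if j ∈ u then γ j else 1 := by
    split_ifs
    exacts [hγ j, zero_le_one]
  rw [← Real.norm_eq_abs, ← Complex.norm_real, localDisc_latticePoint_natCast_div hf hfm q hk]
  refine (mul_le_mul_of_nonneg_left (norm_sum_le _ _)
    (hweight ▸ Finset.prod_nonneg fun j _ ↦ hweight0 j)).trans ?_
  rw [Finset.mul_sum, R]
  refine Finset.sum_le_sum fun h _ ↦ ?_
  rw [norm_prod, hweight, ← Finset.prod_mul_distrib]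
  refine Finset.prod_le_prod (fun j _ ↦ mul_nonneg (hweight0 j) (norm_nonneg _)) fun j _ ↦ ?_
  split_ifs with hj
  · exact mul_norm_walshCoeff_le_rhoW (h j) (hγ j) (hk j)
  · rw [one_mul, hku j hj]
    exact norm_walshCoeff_pow_le_rhoW (h j) (hγ j)

theorem prodWeight_mul_abs_localDisc_fillOne_le {f : (ZMod p)[X]} (hf : f ≠ 0)
    (hfm : f.natDegree = m) (q : Fin s → (ZMod p)[X]) {γ : Fin s → ℝ} (hγ : ∀ i, 0 ≤ γ i)
    {t : Fin s → ℝ} (ht0 : ∀ j, 0 ≤ t j) (ht1 : ∀ j, t j ≤ 1) (u : Finset (Fin s)) :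
    prodWeight γ u * |localDisc (latticePoint p m q f) (fillOne u t)| ≤
      prodWeight γ u * (1 - (1 - 1 / ((p ^ m : ℕ) : ℝ)) ^ u.card) + R p m γ q f := by
  have hweight : 0 ≤ prodWeight γ u := Finset.prod_nonneg fun j _ ↦ hγ j
  have hle (j : Fin s) : fillOne u t j ≤ 1 := by
    rw [fillOne]
    split_ifs
    exacts [ht1 j, le_rfl]
  have hgrid := prodWeight_mul_abs_localDisc_natCast_div_le hf hfm q hγ u
    (k := fun j ↦ ⌈fillOne u t j * (p ^ m : ℕ)⌉₊) (fun j ↦ ceil_mul_le (hle j))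
    fun j hj ↦ by rw [fillOne, if_neg hj, one_mul, Nat.ceil_natCast]
  rw [localDisc_eq_localDisc_roundUp, add_comm (prodWeight γ u * _)]
  refine (mul_le_mul_of_nonneg_left (abs_add_le _ _) hweight).trans ?_
  rw [mul_add]
  exact add_le_add hgrid
    (mul_le_mul_of_nonneg_left (abs_prod_roundUp_fillOne_sub_le ht0 ht1 u) hweight)

theorem weightedStarDisc_latticePoint_le {f : (ZMod p)[X]} (hf : f ≠ 0) (hfm : f.natDegree = m)
    (q : Fin s → (ZMod p)[X]) {γ : Fin s → ℝ} (hγ : ∀ i, 0 ≤ γ i) :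
    weightedStarDisc (prodWeight γ) (latticePoint p m q f) ≤
      (∑ u : Finset (Fin s) with u.Nonempty,
        prodWeight γ u * (1 - (1 - 1 / ((p ^ m : ℕ) : ℝ)) ^ u.card)) + R p m γ q f := by
  have hterm (u : Finset (Fin s)) :
      0 ≤ prodWeight γ u * (1 - (1 - 1 / ((p ^ m : ℕ) : ℝ)) ^ u.card) :=
    mul_nonneg (Finset.prod_nonneg fun j _ ↦ hγ j) <| (abs_nonneg _).trans <|
      abs_prod_roundUp_fillOne_sub_le (t := 0) (fun _ ↦ le_rfl) (fun _ ↦ zero_le_one) u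
  have hbound := add_nonneg (Finset.sum_nonneg fun u (_ : u ∈ Finset.univ.filter
    fun u : Finset (Fin s) ↦ u.Nonempty) ↦ hterm u) (R_nonneg (m := m) hγ q f)
  refine Real.iSup_le (fun t ↦ Real.iSup_le (fun u ↦ ?_) hbound) hbound
  have ht (j : Fin s) := t.2 j trivial
  refine (prodWeight_mul_abs_localDisc_fillOne_le hf hfm q hγ (fun j ↦ (ht j).1.le)
    (fun j ↦ (ht j).2) u.1).trans ?_
  gcongr
  exact Finset.single_le_sum (f := fun u ↦ prodWeight γ u * _) (fun u _ ↦ hterm u)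
    (by simpa using u.2)

end Discrepancy

/-! ### Sums of `rho` over polynomials of bounded degree -/

section RhoSums

theorem rho_zero {p : ℕ} : rho p 0 = 0 := by
  simp [rho]

variable {p : ℕ} [Fact p.Prime] {m : ℕ}

theorem card_degreeLT : Fintype.card (degreeLT (ZMod p) m) = p ^ m := by
  rw [Fintype.card_congr (degreeLTEquiv (ZMod p) m).toEquiv, Fintype.card_fun, ZMod.card,
    Fintype.card_fin]

theorem sum_degreeLT {M : Type*} [AddCommMonoid M] (F : (ZMod p)[X] → M) :
    ∑ h : degreeLT (ZMod p) m, F h = ∑ a : Fin m → ZMod p, F (∑ i : Fin m, monomial i (a i)) :=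
  ((degreeLTEquiv (ZMod p) m).symm.toEquiv.sum_comp fun h ↦ F h).symm

theorem sum_degreeLT_succ {M : Type*} [AddCommMonoid M] (F : (ZMod p)[X] → M) :
    ∑ h : degreeLT (ZMod p) (m + 1), F h =
      ∑ c : ZMod p, ∑ h : degreeLT (ZMod p) m, F (h + monomial m c) := by
  rw [sum_degreeLT, ← (Fin.snocEquiv fun _ ↦ ZMod p).sum_comp, Fintype.sum_prod_type]
  refine Finset.sum_congr rfl fun c _ ↦ ?_
  rw [sum_degreeLT fun h ↦ F (h + monomial m c)]
  simp [Fin.sum_univ_castSucc]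

theorem rho_add_monomial (h : degreeLT (ZMod p) m) {c : ZMod p} (hc : c ≠ 0) :
    rho p (h + monomial m c) =
      1 / (p : ℝ) ^ (m + 1) * (1 / Real.sin (Real.pi / p * c.val) ^ 2) := by
  have hdeg : (h : (ZMod p)[X]).degree < (monomial m c).degree := by
    rw [degree_monomial _ hc]
    exact mem_degreeLT.mp h.2
  rw [rho, natDegree_add_eq_right_of_degree_lt hdeg, natDegree_monomial_eq _ hc,
    leadingCoeff_add_of_degree_lt hdeg, leadingCoeff_monomial, one_div_mul_one_div]

theorem sum_rho :
    ∑ h : degreeLT (ZMod p) m, rho p h = m * ((p : ℝ) ^ 2 - 1) / (3 * p) := by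
  have hp : (p : ℝ) ≠ 0 := NeZero.ne _
  induction m with
  | zero =>
    rw [sum_degreeLT, Fintype.sum_unique, Finset.univ_eq_empty, Finset.sum_empty, rho_zero]
    simp
  | succ m ih =>
    have hlead (c : ZMod p) (hc : c ≠ 0) : ∑ h : degreeLT (ZMod p) m, rho p (h + monomial m c) =
        1 / p * (1 / Real.sin (Real.pi / p * c.val) ^ 2) := by
      simp only [rho_add_monomial _ hc, Finset.sum_const, Finset.card_univ, card_degreeLT,
        nsmul_eq_mul, Nat.cast_pow, ← mul_assoc]
      congr 1
      field_simp
      rw [pow_succ]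
    rw [sum_degreeLT_succ, ← Finset.add_sum_erase _ _ (Finset.mem_univ 0), ← Finset.filter_ne',
      Finset.sum_congr rfl fun c hc ↦ hlead c (Finset.mem_filter.mp hc).2, ← Finset.mul_sum,
      sum_one_div_sin_sq]
    simp only [map_zero, add_zero, ih]
    push_cast
    field_simp

theorem sum_rhoW_mul (γ : ℝ) (F : degreeLT (ZMod p) m → ℝ) :
    ∑ h : degreeLT (ZMod p) m, rhoW p h γ * F h =
      (1 + γ) * F 0 + γ * ∑ h : degreeLT (ZMod p) m, rho p h * F h := by
  have hsplit (h : degreeLT (ZMod p) m) :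
      rhoW p h γ * F h = (if h = 0 then (1 + γ) * F 0 else 0) + γ * (rho p h * F h) := by
    rcases eq_or_ne h 0 with rfl | h0
    · simp [rhoW_zero, rho_zero]
    · simp [rhoW_of_ne_zero (ZeroMemClass.coe_eq_zero.not.mpr h0), h0, mul_assoc]
  simp only [hsplit, Finset.sum_add_distrib, Finset.sum_ite_eq', Finset.mem_univ, if_true,
    Finset.mul_sum]

theorem sum_rhoW (γ : ℝ) :
    ∑ h : degreeLT (ZMod p) m, rhoW p h γ =
      1 + γ + γ * ∑ h : degreeLT (ZMod p) m, rho p h := by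
  simpa only [mul_one] using sum_rhoW_mul γ fun _ : degreeLT (ZMod p) m ↦ 1

theorem pow_mul_sum_rho_le {n : ℕ} (hn : n ≠ 0) :
    (p : ℝ) ^ n * ∑ h : degreeLT (ZMod p) m, rho p h ≤ (p ^ n - 1) * (m * ((p + 1) / 3)) := by
  have hp : (0 : ℝ) < p := Nat.cast_pos.mpr (NeZero.pos p)
  have hpn : (p : ℝ) ≤ p ^ n := le_self_pow₀ (Nat.one_le_cast.mpr (NeZero.pos p)) hn
  calc (p : ℝ) ^ n * ∑ h : degreeLT (ZMod p) m, rho p h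
      = (p ^ n - p ^ n / p) * (m * ((p + 1) / 3)) := by
        rw [sum_rho]
        field_simp
        ring
    _ ≤ (p ^ n - 1) * (m * ((p + 1) / 3)) := by
        gcongr
        exact (one_le_div hp).mpr hpn

theorem sum_rho_le : ∑ h : degreeLT (ZMod p) m, rho p h ≤ m * (((p : ℝ) + 1) / 3) := by
  have hp : (0 : ℝ) < p := Nat.cast_pos.mpr (NeZero.pos p)
  have h := pow_mul_sum_rho_le (p := p) (m := m) one_ne_zero
  rw [pow_one] at h
  refine le_of_mul_le_mul_left (h.trans ?_) hp
  gcongr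
  exact sub_le_self _ zero_le_one

end RhoSums

/-! ### The component-by-component bound -/

section ComponentByComponent

variable {p : ℕ} [Fact p.Prime] {m d : ℕ}

open Classical in
/-- The sum of `∏ r_p(h_i, γ_i)` over all `h ∈ G_{p,m}^d` with `h · q + b ≡ 0 (mod f)`. Summing
over an inhomogeneous congruence makes the recursion over the number of coordinates close up. -/
def congruenceSum (m : ℕ) (γ : Fin d → ℝ) (q : Fin d → (ZMod p)[X]) (f b : (ZMod p)[X]) : ℝ :=
  ∑ h : Fin d → degreeLT (ZMod p) m with f ∣ ∑ i, (h i : (ZMod p)[X]) * q i + b,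
    ∏ i, rhoW p (h i) (γ i)

/-- The part of `R` in dimension `d + 1`, divided by `γ_{d+1}`, that depends on the last component
`x` of the generating vector: it collects the dual vectors whose last entry is nonzero (the term
`a = 0` vanishes because `rho p 0 = 0`). -/
def extensionSum (m : ℕ) (γ : Fin d → ℝ) (q : Fin d → (ZMod p)[X]) (f x : (ZMod p)[X]) : ℝ :=
  ∑ a : degreeLT (ZMod p) m, rho p a * congruenceSum m γ q f (a * x)

theorem congruenceSum_zero (γ : Fin d → ℝ) (q : Fin d → (ZMod p)[X]) (f : (ZMod p)[X]) :
    congruenceSum m γ q f 0 = ∏ i, (1 + γ i) + R p m γ q f := by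
  classical
  have hzero : ∏ i, (1 + γ i) =
      ∏ i, rhoW p ((0 : Fin d → degreeLT (ZMod p) m) i : (ZMod p)[X]) (γ i) :=
    Finset.prod_congr rfl fun _ _ ↦ rhoW_zero.symm
  simp only [congruenceSum, R, add_zero, hzero]
  rw [← Finset.filter_filter, Finset.filter_ne', Finset.filter_erase]
  exact (Finset.add_sum_erase _ _ (by simp)).symm

theorem congruenceSum_succ (γ : Fin (d + 1) → ℝ) (q : Fin (d + 1) → (ZMod p)[X])
    (f b : (ZMod p)[X]) :
    congruenceSum m γ q f b = ∑ a : degreeLT (ZMod p) m, rhoW p a (γ (Fin.last d)) *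
      congruenceSum m (Fin.init γ) (Fin.init q) f (a * q (Fin.last d) + b) := by
  classical
  simp only [congruenceSum, Finset.sum_filter, Finset.mul_sum]
  rw [← (Fin.snocEquiv fun _ ↦ degreeLT (ZMod p) m).sum_comp, Fintype.sum_prod_type]
  refine Finset.sum_congr rfl fun a _ ↦ Finset.sum_congr rfl fun h _ ↦ ?_
  rw [mul_ite, mul_zero]
  refine if_congr ?_ ?_ rfl
  · simp [Fin.sum_univ_castSucc, Fin.init, Fin.snocEquiv, add_assoc]
  · simp [Fin.prod_univ_castSucc, Fin.init, Fin.snocEquiv, mul_comm]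

theorem R_succ (γ : Fin (d + 1) → ℝ) (q : Fin (d + 1) → (ZMod p)[X]) (f : (ZMod p)[X]) :
    R p m γ q f = (1 + γ (Fin.last d)) * R p m (Fin.init γ) (Fin.init q) f +
      γ (Fin.last d) * extensionSum m (Fin.init γ) (Fin.init q) f (q (Fin.last d)) := by
  have h := congruenceSum_succ (m := m) γ q f 0
  simp only [add_zero] at h
  rw [sum_rhoW_mul (γ (Fin.last d)) fun a : degreeLT (ZMod p) m ↦
    congruenceSum m (Fin.init γ) (Fin.init q) f (a * q (Fin.last d)), ZeroMemClass.coe_zero,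
    zero_mul, congruenceSum_zero, congruenceSum_zero, Fin.prod_univ_castSucc] at h
  simp only [Fin.init] at h ⊢
  rw [extensionSum]
  linear_combination h

theorem sum_congruenceSum_le {γ : Fin d → ℝ} (hγ : ∀ i, 0 ≤ γ i) (q : Fin d → (ZMod p)[X])
    (f : (ZMod p)[X]) {ι : Type*} {S : Finset ι} {b : ι → (ZMod p)[X]}
    (hb : ∀ x ∈ S, ∀ y ∈ S, f ∣ b x - b y → x = y) :
    ∑ x ∈ S, congruenceSum m γ q f (b x) ≤ ∏ i, ∑ h : degreeLT (ZMod p) m, rhoW p h (γ i) := by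
  classical
  rw [Fintype.prod_sum]
  simp only [congruenceSum, Finset.sum_filter]
  rw [Finset.sum_comm]
  refine Finset.sum_le_sum fun h _ ↦ ?_
  rw [← Finset.sum_filter, Finset.sum_const, nsmul_eq_mul]
  refine mul_le_of_le_one_left (Finset.prod_nonneg fun i _ ↦ rhoW_nonneg _ (hγ i)) ?_
  rw [Nat.cast_le_one, Finset.card_le_one]
  intro x hx y hy
  rw [Finset.mem_filter] at hx hy
  refine hb x hx.1 y hy.1 ?_
  simpa only [add_sub_add_left_eq_sub] using dvd_sub hx.2 hy.2

theorem eq_zero_of_dvd_of_degree_lt_natDegree {f a : (ZMod p)[X]} (h : f ∣ a)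
    (hdeg : a.degree < f.natDegree) : a = 0 := by
  by_contra ha
  exact ((natDegree_lt_iff_degree_lt ha).mpr hdeg).not_ge (natDegree_le_of_dvd h ha)

theorem sum_extensionSum_le {γ : Fin d → ℝ} (hγ : ∀ i, 0 ≤ γ i) (q : Fin d → (ZMod p)[X])
    {f : (ZMod p)[X]} (hf : Prime f) (hfm : f.natDegree = m) {ι : Type*} {S : Finset ι}
    {x : ι → (ZMod p)[X]} (hx : ∀ i ∈ S, ∀ j ∈ S, f ∣ x i - x j → i = j) :
    ∑ i ∈ S, extensionSum m γ q f (x i) ≤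
      (∑ h : degreeLT (ZMod p) m, rho p h) * ∏ i, ∑ h : degreeLT (ZMod p) m, rhoW p h (γ i) := by
  simp only [extensionSum]
  rw [Finset.sum_comm, Finset.sum_mul]
  refine Finset.sum_le_sum fun a _ ↦ ?_
  rw [← Finset.mul_sum]
  rcases eq_or_ne (a : (ZMod p)[X]) 0 with ha | ha
  · rw [ha, rho_zero, zero_mul, zero_mul]
  · refine mul_le_mul_of_nonneg_left (sum_congruenceSum_le hγ q f fun i hi j hj hij ↦ ?_)
      (rho_nonneg _)
    rw [← mul_sub] at hij
    exact hx i hi j hj ((hf.dvd_or_dvd hij).resolve_left fun hfa ↦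
      ha (eq_zero_of_dvd_of_degree_lt_natDegree hfa (by rw [hfm]; exact mem_degreeLT.mp a.2)))

theorem eq_of_dvd_X_pow_mul_sub {w : ℕ} {f : (ZMod p)[X]} (hfm : f.natDegree = m) (hw : w ≤ m)
    {x y : degreeLT (ZMod p) (m - w)}
    (h : f ∣ X ^ w * (x : (ZMod p)[X]) - X ^ w * (y : (ZMod p)[X])) : x = y := by
  rw [← mul_sub] at h
  have hdeg : (X ^ w * ((x : (ZMod p)[X]) - (y : (ZMod p)[X]))).degree <
      (f.natDegree : WithBot ℕ) := by
    have hsum : (f.natDegree : WithBot ℕ) = w + (m - w : ℕ) := by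
      rw [hfm, ← Nat.cast_add, Nat.add_sub_cancel' hw]
    rw [degree_mul, degree_X_pow, hsum]
    exact WithBot.add_lt_add_left WithBot.coe_ne_bot (mem_degreeLT.mp (x - y).2)
  have hxy := eq_zero_of_dvd_of_degree_lt_natDegree h hdeg
  exact Subtype.ext (sub_eq_zero.mp ((mul_eq_zero.mp hxy).resolve_left (pow_ne_zero _ X_ne_zero)))

theorem mem_searchSet {w : ℕ} {f : (ZMod p)[X]} (hf : Irreducible f) (hfm : f.natDegree = m)
    (hw : w < m) {x : degreeLT (ZMod p) (m - w)} (hx : x ≠ 0) :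
    (x : (ZMod p)[X]) ∈ searchSet p m w f := by
  have hdeg := mem_degreeLT.mp x.2
  have hle : ((m - w : ℕ) : WithBot ℕ) ≤ f.natDegree := by
    rw [hfm]
    exact Nat.cast_le.mpr (Nat.sub_le m w)
  rw [searchSet, if_pos hw]
  refine ⟨hdeg, ((hf.coprime_iff_not_dvd).mpr fun h ↦ hx ?_).symm⟩
  exact Subtype.ext (eq_zero_of_dvd_of_degree_lt_natDegree h (hdeg.trans_le hle))

theorem exists_ne_zero_pow_mul_extensionSum_le {γ : Fin d → ℝ} (hγ : ∀ i, 0 ≤ γ i)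
    (q : Fin d → (ZMod p)[X]) {f : (ZMod p)[X]} (hf : Prime f) (hfm : f.natDegree = m) {w : ℕ}
    (hw : w < m) : ∃ x : degreeLT (ZMod p) (m - w), x ≠ 0 ∧
      (p : ℝ) ^ (m - w) * extensionSum m γ q f ((X : (ZMod p)[X]) ^ w * x) ≤
        m * ((p + 1) / 3) * ∏ i, ∑ h : degreeLT (ZMod p) m, rhoW p h (γ i) := by
  classical
  set S := Finset.univ.erase (0 : degreeLT (ZMod p) (m - w))
  set W := ∏ i, ∑ h : degreeLT (ZMod p) m, rhoW p h (γ i)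
  have hW : 0 ≤ W :=
    Finset.prod_nonneg fun i _ ↦ Finset.sum_nonneg fun h _ ↦ rhoW_nonneg _ (hγ i)
  have hn : m - w ≠ 0 := Nat.sub_ne_zero_of_lt hw
  have hScard : S.card = p ^ (m - w) - 1 := by
    rw [Finset.card_erase_of_mem (Finset.mem_univ _), Finset.card_univ, card_degreeLT]
  have hSne : S.Nonempty := by
    rw [← Finset.card_pos, hScard]
    exact Nat.sub_pos_of_lt (Nat.one_lt_pow hn (Fact.out : p.Prime).one_lt)
  have hmean : ∑ x ∈ S, (p : ℝ) ^ (m - w) * extensionSum m γ q f ((X : (ZMod p)[X]) ^ w * x) ≤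
      ∑ _x ∈ S, m * ((p + 1) / 3) * W := by
    rw [← Finset.mul_sum, Finset.sum_const, hScard, nsmul_eq_mul, Nat.cast_pred (NeZero.pos _),
      Nat.cast_pow]
    calc (p : ℝ) ^ (m - w) * ∑ x ∈ S, extensionSum m γ q f ((X : (ZMod p)[X]) ^ w * x)
        ≤ p ^ (m - w) * ((∑ h : degreeLT (ZMod p) m, rho p h) * W) := by
          gcongr
          exact sum_extensionSum_le hγ q hf hfm fun _ _ _ _ ↦ eq_of_dvd_X_pow_mul_sub hfm hw.le
      _ ≤ (p ^ (m - w) - 1) * (m * ((p + 1) / 3) * W) := by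
          rw [← mul_assoc, ← mul_assoc]
          exact mul_le_mul_of_nonneg_right (pow_mul_sum_rho_le hn) hW
  obtain ⟨x, hx, hle⟩ := Finset.exists_le_of_sum_le hSne hmean
  exact ⟨x, Finset.ne_of_mem_erase hx, hle⟩

theorem exists_mem_searchSet_pow_mul_extensionSum_le {γ : Fin d → ℝ} (hγ : ∀ i, 0 ≤ γ i)
    (q : Fin d → (ZMod p)[X]) {f : (ZMod p)[X]} (hf : Irreducible f) (hfm : f.natDegree = m)
    (w : ℕ) : ∃ x ∈ searchSet p m w f,
      (p : ℝ) ^ (m - w) * extensionSum m γ q f (X ^ w * x) ≤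
        m * ((p + 1) / 3) * ∏ i, ∑ h : degreeLT (ZMod p) m, rhoW p h (γ i) := by
  rcases le_or_gt m w with hmw | hwm
  · refine ⟨1, by rw [searchSet, if_neg hmw.not_gt, Set.mem_singleton_iff], ?_⟩
    have hone := sum_extensionSum_le hγ q hf.prime hfm (S := {()}) (x := fun _ ↦ X ^ w * 1)
      fun _ _ _ _ _ ↦ rfl
    rw [Finset.sum_singleton] at hone
    rw [Nat.sub_eq_zero_of_le hmw, pow_zero, one_mul]
    exact hone.trans (mul_le_mul_of_nonneg_right sum_rho_le
      (Finset.prod_nonneg fun i _ ↦ Finset.sum_nonneg fun h _ ↦ rhoW_nonneg _ (hγ i)))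
  · obtain ⟨x, hx, hle⟩ := exists_ne_zero_pow_mul_extensionSum_le hγ q hf.prime hfm hwm
    exact ⟨x, mem_searchSet hf hfm hwm hx, hle⟩

theorem R_extendBy {s : ℕ} (γ : Fin (d + 1) → ℝ) (w : ℕ → ℕ) (g : Fin s → (ZMod p)[X]) (hd : d < s)
    (q f : (ZMod p)[X]) :
    R p m γ (extendBy w g ⟨d, hd⟩ q) f =
      (1 + γ (Fin.last d)) *
          R p m (Fin.init γ) (fun i ↦ X ^ w i * g (i.castLE hd.le)) f +
        γ (Fin.last d) *
          extensionSum m (Fin.init γ) (fun i ↦ X ^ w i * g (i.castLE hd.le)) f (X ^ w d * q) := by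
  rw [R_succ]
  simp only [extendBy, Fin.init_snoc, Fin.snoc_last]

theorem R_X_pow_eq_zero (γ : Fin 1 → ℝ) {w : ℕ} (hw : w < m) {f : (ZMod p)[X]} (hf : Prime f)
    (hfm : f.natDegree = m) : R p m γ (fun _ ↦ X ^ w) f = 0 := by
  have hX : ¬ f ∣ X ^ w := fun h ↦ pow_ne_zero w X_ne_zero <|
    eq_zero_of_dvd_of_degree_lt_natDegree h <| by
      rw [degree_X_pow, hfm]
      exact Nat.cast_lt.mpr hw
  classical
  refine Finset.sum_eq_zero fun h hh ↦ ?_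
  obtain ⟨-, hne, hdvd⟩ := Finset.mem_filter.mp hh
  refine absurd ?_ hne
  rw [Fin.sum_univ_one] at hdvd
  have h0 := eq_zero_of_dvd_of_degree_lt_natDegree ((hf.dvd_or_dvd hdvd).resolve_right hX) <| by
    rw [hfm]
    exact mem_degreeLT.mp (h 0).2
  ext1 i
  rw [Subsingleton.elim i 0]
  exact Subtype.ext h0

variable {s : ℕ} {γ : ℕ → ℝ} {w : ℕ → ℕ} {f : (ZMod p)[X]} {g : Fin s → (ZMod p)[X]}

theorem IsReducedCBC.R_extendBy_le (hg : IsReducedCBC p m γ w f g) (hγ : ∀ j, 0 ≤ γ j)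
    (hf : Prime f) (hfm : f.natDegree = m) (d : Fin s) {q : (ZMod p)[X]}
    (hq : q ∈ searchSet p m (w d) f) :
    R p m (fun i : Fin (d + 1) ↦ γ i) (extendBy w g d (g d)) f ≤
      R p m (fun i : Fin (d + 1) ↦ γ i) (extendBy w g d q) f := by
  rcases eq_or_ne d.val 0 with hd | hd
  · rcases lt_or_ge (w d) m with hw | hw
    · obtain ⟨d, hds⟩ := d
      obtain rfl : d = 0 := hd
      have hX : extendBy w g ⟨0, hds⟩ (g ⟨0, hds⟩) = fun _ ↦ X ^ w 0 := by
        ext1 i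
        rw [Subsingleton.elim (α := Fin 1) i (Fin.last 0), extendBy, Fin.snoc_last,
          hg.first _ rfl, mul_one]
      rw [hX, R_X_pow_eq_zero _ hw hf hfm]
      exact R_nonneg (fun i ↦ hγ i) _ _
    · rw [searchSet, if_neg hw.not_gt, Set.mem_singleton_iff] at hq
      rw [hq, hg.first d hd]
  · exact hg.step d hd q hq

theorem IsReducedCBC.pow_mul_extensionSum_le (hg : IsReducedCBC p m γ w f g)
    (hγ : ∀ j, 0 ≤ γ j) (hf : Irreducible f) (hfm : f.natDegree = m) (hd : d < s) :
    (p : ℝ) ^ (m - w d) * (γ d * extensionSum m (fun i : Fin d ↦ γ i)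
        (fun i ↦ X ^ w i * g (i.castLE hd.le)) f (X ^ w d * g ⟨d, hd⟩)) ≤
      γ d * (m * ((p + 1) / 3) * ∏ i : Fin d, ∑ h : degreeLT (ZMod p) m, rhoW p h (γ i)) := by
  obtain ⟨q, hq, hle⟩ := exists_mem_searchSet_pow_mul_extensionSum_le (fun i : Fin d ↦ hγ i)
    (fun i ↦ X ^ w i * g (i.castLE hd.le)) hf hfm (w d)
  have hmin := hg.R_extendBy_le hγ hf.prime hfm ⟨d, hd⟩ hq
  rw [R_extendBy, R_extendBy] at hmin
  refine (mul_le_mul_of_nonneg_left (le_of_add_le_add_left hmin) (by positivity)).trans ?_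
  rw [mul_left_comm]
  exact mul_le_mul_of_nonneg_left hle (hγ d)

theorem sum_rhoW_le {c : ℝ} (hc : 0 ≤ c) (w : ℕ) :
    ∑ h : degreeLT (ZMod p) m, rhoW p h c ≤
      1 + c + c * (p : ℝ) ^ min w m * (m : ℝ) * (((p : ℝ) + 1) / 3) := by
  rw [sum_rhoW, mul_assoc, mul_assoc c]
  have hpow : 1 ≤ (p : ℝ) ^ min w m := one_le_pow₀ (Nat.one_le_cast.mpr (NeZero.pos p))
  gcongr
  exact sum_rho_le.trans (le_mul_of_one_le_left (by positivity) hpow)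

theorem IsReducedCBC.mul_extensionSum_le (hg : IsReducedCBC p m γ w f g)
    (hγ : ∀ j, 0 ≤ γ j) (hf : Irreducible f) (hfm : f.natDegree = m) (hd : d < s) :
    γ d * extensionSum m (fun i : Fin d ↦ γ i) (fun i ↦ X ^ w i * g (i.castLE hd.le)) f
        (X ^ w d * g ⟨d, hd⟩) ≤
      1 / (p : ℝ) ^ m * (γ d * (p : ℝ) ^ min (w d) m * (m : ℝ) * (((p : ℝ) + 1) / 3)) *
        ∏ i : Fin d, (1 + γ i + γ i * (p : ℝ) ^ min (w i) m * (m : ℝ) * (((p : ℝ) + 1) / 3)) := by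
  have hp : (0 : ℝ) < p := Nat.cast_pos.mpr (NeZero.pos p)
  have hpow : (p : ℝ) ^ m = p ^ min (w d) m * p ^ (m - w d) := by
    rw [← pow_add, min_comm, Nat.add_comm, Nat.sub_add_min_cancel]
  have hprod : ∏ i : Fin d, ∑ h : degreeLT (ZMod p) m, rhoW p h (γ i) ≤
      ∏ i : Fin d, (1 + γ i + γ i * (p : ℝ) ^ min (w i) m * (m : ℝ) * (((p : ℝ) + 1) / 3)) :=
    Finset.prod_le_prod (fun i _ ↦ Finset.sum_nonneg fun h _ ↦ rhoW_nonneg _ (hγ i))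
      fun i _ ↦ sum_rhoW_le (hγ i) (w i)
  have hle := (hg.pow_mul_extensionSum_le hγ hf hfm hd).trans <|
    mul_le_mul_of_nonneg_left (mul_le_mul_of_nonneg_left hprod (by positivity)) (hγ d)
  rw [← le_div_iff₀' (by positivity)] at hle
  refine hle.trans_eq ?_
  rw [hpow]
  field_simp

theorem IsReducedCBC.R_le (hg : IsReducedCBC p m γ w f g) (hγ : ∀ j, 0 ≤ γ j)
    (hf : Irreducible f) (hfm : f.natDegree = m) (hd : d ≤ s) :
    R p m (fun i : Fin d ↦ γ i) (fun i ↦ X ^ w i * g (i.castLE hd)) f ≤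
      1 / (p : ℝ) ^ m * ∏ i : Fin d,
        (1 + γ i + γ i * (p : ℝ) ^ min (w i) m * (m : ℝ) * (((p : ℝ) + 1) / 3)) := by
  induction d with
  | zero =>
    classical
    rw [R, Finset.filter_false_of_mem fun h _ hh ↦ hh.1 (Subsingleton.elim h 0), Finset.sum_empty]
    positivity
  | succ d ih =>
    have hγd := hγ d
    have hinit := mul_le_mul_of_nonneg_left (ih (Nat.le_of_succ_le hd)) (add_nonneg zero_le_one hγd)
    have hlast := hg.mul_extensionSum_le hγ hf hfm hd
    refine (R_succ _ _ _).trans_le ((add_le_add hinit hlast).trans_eq ?_)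
    rw [Fin.prod_univ_castSucc]
    simp only [Fin.val_castSucc, Fin.val_last]
    ring

end ComponentByComponent

end PolyLattice

end

theorem mainTheorem5_general (p : ℕ) [Fact p.Prime] (m s : ℕ) (γ : ℕ → ℝ) (hγ : ∀ j, 0 ≤ γ j)
    (w : ℕ → ℕ) (f : (ZMod p)[X]) (hf : Irreducible f) (hfm : f.natDegree = m)
    (g : Fin s → (ZMod p)[X]) (hg : PolyLattice.IsReducedCBC p m γ w f g)
    (N : ℕ) (hN : N = p ^ m) :
    PolyLattice.weightedStarDisc (PolyLattice.prodWeight fun i : Fin s => γ i.val)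
        (PolyLattice.latticePoint p m (fun i : Fin s => X ^ w i.val * g i) f) ≤
      (∑ u : Finset (Fin s) with u.Nonempty,
          PolyLattice.prodWeight (fun i : Fin s => γ i.val) u *
            (1 - (1 - 1 / (N : ℝ)) ^ u.card)) +
        1 / (N : ℝ) *
          ∏ i : Fin s, (1 + γ i.val +
            γ i.val * (p : ℝ) ^ min (w i.val) m * (m : ℝ) * (((p : ℝ) + 1) / 3)) := by
  subst hN
  have hdisc := PolyLattice.weightedStarDisc_latticePoint_le hf.ne_zero hfm
    (fun i : Fin s ↦ X ^ w i.val * g i) fun i ↦ hγ i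
  have hR := hg.R_le hγ hf hfm le_rfl
  rw [← Nat.cast_pow] at hR
  exact hdisc.trans (add_le_add_right hR _)

theorem mainTheorem5 (p : ℕ) [Fact p.Prime] (m s : ℕ) (hs : 1 ≤ s)
    (γ : ℕ → ℝ) (hγ_pos : ∀ j, 0 < γ j) (hγ_le : ∀ j, γ j ≤ 1) (hγ_anti : Antitone γ)
    (w : ℕ → ℕ) (hw : Monotone w)
    (f : (ZMod p)[X]) (hf : Irreducible f) (hfm : f.natDegree = m)
    (g : Fin s → (ZMod p)[X]) (hg : PolyLattice.IsReducedCBC p m γ w f g)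
    (N : ℕ) (hN : N = p ^ m) :
    PolyLattice.weightedStarDisc (PolyLattice.prodWeight fun i : Fin s => γ i.val)
        (PolyLattice.latticePoint p m (fun i : Fin s => X ^ w i.val * g i) f) ≤
      (∑ u : Finset (Fin s) with u.Nonempty,
          PolyLattice.prodWeight (fun i : Fin s => γ i.val) u *
            (1 - (1 - 1 / (N : ℝ)) ^ u.card)) +
        1 / (N : ℝ) *
          ∏ i : Fin s, (1 + γ i.val +
            γ i.val * (p : ℝ) ^ min (w i.val) m * (m : ℝ) * (((p : ℝ) + 1) / 3)) :=
  mainTheorem5_general p m s γ (fun j ↦ (hγ_pos j).le) w f hf hfm g hg N hN
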